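/- For a topological group $G$ and $m\in\mathbb N$ let $a^{\triangleleft}_m(G)$ be the number of open normal subgroups of $G$ of index $m$, and let $$\zeta^{\triangleleft}_G(s)=\sum_{m\ge 1}a^{\triangleleft}_m(G)\,m^{-s}$$ be the normal zeta function of $G$. For the abelian group $G=\mathbb Z_p^{d}$ write $\zeta_{\mathbb Z_p^{d}}(s)=\zeta^{\triangleleft}_{\mathbb Z_p^{d}}(s)$. For a commutative (topological) ring $R$ let $H(R)$ be the Heisenberg group of upper unitriangular $3\times 3$ matrices over $R$. For $0\le b\le a$ put $$\binom{a}{b}_Y=\frac{\prod_{i=a-b+1}^{a}(1-Y^i)}{\prod_{i=1}^{b}(1-Y^i)},$$ and for $I=\{i_1<\dots<i_\ell\}\subseteq[n-1]=\{1,\dots,n-1\}$ put $$\binom{n}{I}_Y=\binom{n}{i_\ell}_Y\binom{i_\ell}{i_{\ell-1}}_Y\cdots\binom{i_2}{i_1}_Y$$ (which is $1$ for $I=\varnothing$). **Theorem.** Let $p$ be a prime and let $R$ be a finite unramified extension of $\mathbb Z_p$, i.e. a compact discrete valuation ring that is finite over $\mathbb Z_p$ and whose maximal ideal is $pR$. Let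 $n$ be the rank of $R$ as a $\mathbb Z_p$-module. For $0\le i\le n-1$ set $x_i=p^{(2n+i)(n-i)-(3n-i)s}$. Then $H(R)$ and $\mathbb Z_p^{2n}$ have only finitely many open normal subgroups of each finite index, and for every complex $s$ with $\operatorname{Re}(s)>2n-1$ the series defining $\zeta^{\triangleleft}_{H(R)}(s)$ and $\zeta_{\mathbb Z_p^{2n}}(s)$ converge absolutely and $$\zeta^{\triangleleft}_{H(R)}(s)=\zeta_{\mathbb Z_p^{2n}}(s)\,\frac{1}{1-x_0}\sum_{I\subseteq[n-1]}\binom{n}{I}_{p^{-1}}\prod_{i\in I}\frac{x_i}{1-x_i}.$$ -/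

import Mathlib

open Matrix

/-- The Heisenberg group `H(R)`: the group of upper unitriangular `3 × 3` matrices over `R`. -/
def heisenbergGroup (R : Type*) [CommRing R] : Subgroup (GL (Fin 3) R) where
  carrier := {g | ∃ a b c : R, (g : Matrix (Fin 3) (Fin 3) R) = !![1, a, c; 0, 1, b; 0, 0, 1]}
  one_mem' := ⟨0, 0, 0, by
    ext i j; fin_cases i <;> fin_cases j <;> simp⟩
  mul_mem' := by
    rintro g h ⟨a, b, c, hg⟩ ⟨a', b', c', hh⟩
    refine ⟨a + a', b + b', c' + a * b' + c, ?_⟩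
    rw [Units.val_mul, hg, hh]
    ext i j; fin_cases i <;> fin_cases j <;>
      simp [Matrix.mul_apply, Fin.sum_univ_three, add_comm]
  inv_mem' := by
    rintro g ⟨a, b, c, hg⟩
    refine ⟨-a, -b, a * b - c, ?_⟩
    refine Units.inv_eq_of_mul_eq_one_right ?_
    rw [hg]
    ext i j; fin_cases i <;> fin_cases j <;>
      simp [Matrix.mul_apply, Fin.sum_univ_three]
    ring

/-- The set of open normal subgroups of index `m` in the topological group `G`.  (For an abstract
group `G` one takes the discrete topology.) -/
def normalSubgroupsOfIndex (G : Type*) [Group G] [TopologicalSpace G] (m : ℕ) :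
    Set (Subgroup G) :=
  {N | N.Normal ∧ IsOpen (N : Set G) ∧ N.index = m}

/-- The coefficients `m ↦ a_m(G)` of the normal zeta function: the number of open normal subgroups
of index `m` in `G`.  (The value at `0`, where `Subgroup.index` records infinite index, is not
used by `LSeries`.) -/
noncomputable def normalSubgroupCount (G : Type*) [Group G] [TopologicalSpace G] (m : ℕ) : ℂ :=
  ((normalSubgroupsOfIndex G m).ncard : ℂ)

/-- The normal zeta function `∑_{m ≥ 1} a_m(G) m^{-s}` of `G`. -/
noncomputable def normalZeta (G : Type*) [Group G] [TopologicalSpace G] (s : ℂ) : ℂ :=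
  LSeries (normalSubgroupCount G) s

/-- The Gaussian binomial coefficient `binom(a, b)_Y`, for `b ≤ a`, evaluated at a number `Y` with
`Y ^ i ≠ 1` for `1 ≤ i ≤ b`. -/
noncomputable def gaussBinom {K : Type*} [Field K] (Y : K) (a b : ℕ) : K :=
  (∏ i ∈ Finset.Icc (a - b + 1) a, (1 - Y ^ i)) / ∏ i ∈ Finset.Icc 1 b, (1 - Y ^ i)

/-- `gaussChain Y n [j₁, j₂, …, jₗ] = binom(n, j₁)_Y * binom(j₁, j₂)_Y * ⋯ * binom(jₗ₋₁, jₗ)_Y`. -/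
noncomputable def gaussChain {K : Type*} [Field K] (Y : K) : ℕ → List ℕ → K
  | _, [] => 1
  | a, j :: l => gaussBinom Y a j * gaussChain Y j l

/-- The Gaussian multinomial `binom(n, I)_Y`: for `I = {i₁ < ⋯ < iₗ}` it is
`binom(n, iₗ)_Y * binom(iₗ, iₗ₋₁)_Y * ⋯ * binom(i₂, i₁)_Y`. -/
noncomputable def gaussMultinomial {K : Type*} [Field K] (Y : K) (n : ℕ) (I : Finset ℕ) : K :=
  gaussChain Y n (I.sort (· ≥ ·))

/-- The numerical data `x_i = p ^ ((2n + i)(n - i) - (3n - i)s)`. -/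
noncomputable def numericalDatum (p n : ℕ) (s : ℂ) (i : ℕ) : ℂ :=
  (p : ℂ) ^ ((2 * n + i : ℂ) * (n - i) - (3 * n - i) * s)

/-! A normal subgroup N of H(R) with lattice parts is the same as a triple: its intersection L with
the center R, its image M in R × R, and a homomorphism M → R/L that records corner entries modulo L
(`heisLatticeEquiv`). Commutators force the coordinates of elements of M to generate ideals inside
L, and this suffices for normality. As p is a uniformizer, the condition reads M ⊆ p^k (R × R),
where k is the depth of L, the least k with p^k R ⊆ L (`heisCompat_iff`). Write M = p^k M' with M'
an arbitrary lattice. Then N has index |R:L| · p^(2nk) · |R²:M'|, and there are |R:L|^(2n)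
homomorphisms. Hence the zeta function is that of ℤ_p^(2n) times the sum over L of u^e v^k, where
|R:L| = p^e, u = p^(2n-s) and v = p^(-2ns).

That sum depends only on the rank n of the lattice V = R (`tsum_lattice`). Passing from L ≠ V to up
L = {x : px ∈ L} lowers the depth by one. Let d be the dimension of the image of L in V/pV. The
lattices L with up L = N are the subspaces of N/pN that avoid the kernel of N/pN → V/pV; if N has
residual dimension w, there are p^(d(n-d)) binom(w,d)_(1/p) of them with residual dimension d. So
the partial sums G_d satisfy G_n = 1 and G_d = x_d ∑_{w ≥ d} binom(w,d)_(1/p) G_w for d < n, with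
x_d = p^(d(n-d)) u^(n-d) v. Solving for G_d gives factors z_d = x_d/(1-x_d), and iterating gives a
sum over chains below n. Since binom(a,0) = 1, the index 0 only contributes the factor 1 + z_0 =
1/(1-x_0) (`sum_eq_multinomialSum`).

Absolute convergence follows from the same triangular recursion for the norms, whose diagonal
coefficients |x_d| are less than 1. -/

/-! ### Counting subspaces that avoid a given subspace -/

section SubspaceCount

variable {F X : Type*} [Field F] [Fintype F] [AddCommGroup X] [Module F X]

/-- The number of linearly independent `d`-tuples, without a bound on `d`. -/
theorem card_linearIndependent_eq_prod_range [Finite X] (d : ℕ) :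
    Nat.card {v : Fin d → X // LinearIndependent F v} =
      ∏ i ∈ Finset.range d, (Nat.card X - Fintype.card F ^ i) := by
  have hX : Nat.card X = Fintype.card F ^ Module.finrank F X := by
    rw [Module.natCard_eq_pow_finrank (K := F), Nat.card_eq_fintype_card]
  rcases le_or_gt d (Module.finrank F X) with h | h
  · rw [card_linearIndependent h, hX, Finset.prod_range]
  -- Above the dimension both sides vanish: the factor with i = dim X is zero.
  · rw [Finset.prod_eq_zero (Finset.mem_range.2 h) (by rw [hX, Nat.sub_self])]
    have : IsEmpty {v : Fin d → X // LinearIndependent F v} :=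
      ⟨fun v => by simpa using (v.2.fintype_card_le_finrank.trans_lt h).ne⟩
    exact Nat.card_of_isEmpty

/-- Families that are independent modulo `K`, as families modulo `K` together with a family in
`K`. -/
noncomputable def liftIndependentEquiv (K : Submodule F X) (d : ℕ) :
    {v : Fin d → X // LinearIndependent F (K.mkQ ∘ v)} ≃
      {t : Fin d → X ⧸ K // LinearIndependent F t} × (Fin d → K) where
  toFun v := (⟨K.mkQ ∘ v.1, v.2⟩, fun i => ⟨v.1 i - (K.mkQ (v.1 i)).out, by
    refine (Submodule.Quotient.eq K).1 ?_
    exact (Submodule.Quotient.mk_out (p := K) _).symm⟩)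
  invFun a := ⟨fun i => (a.1.1 i).out + a.2 i, by
    convert a.1.2 using 1
    ext i
    simp⟩
  left_inv v := by
    ext i
    simp
  right_inv a := by
    have h (i) : K.mkQ ((a.1.1 i).out + a.2 i) = a.1.1 i := by simp
    refine Prod.ext (Subtype.ext (funext h)) (funext fun i => Subtype.ext ?_)
    simp only [h]
    simp

/-- Families that are independent modulo `K`, sorted by their span. -/
noncomputable def independentSpanEquiv (K : Submodule F X) [Finite X] (d : ℕ) :
    (Σ U : {U : Submodule F X // Module.finrank F U = d ∧ Disjoint U K},
      {v : Fin d → U.1 // LinearIndependent F v}) ≃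
      {v : Fin d → X // LinearIndependent F (K.mkQ ∘ v)} := by
  refine Equiv.ofBijective (fun a => ⟨fun i => (a.2.1 i : X), ?_⟩) ⟨?_, ?_⟩
  · have h1 : LinearIndependent F (a.1.1.subtype ∘ a.2.1) := a.2.2.map' _ (by simp)
    refine h1.map ?_
    rw [Submodule.ker_mkQ]
    exact a.1.2.2.mono_left (Submodule.span_le.2 (by rintro _ ⟨i, rfl⟩; exact (a.2.1 i).2))
  · have span_eq (a : Σ U : {U : Submodule F X // Module.finrank F U = d ∧ Disjoint U K},
        {v : Fin d → U.1 // LinearIndependent F v}) :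
        Submodule.span F (Set.range fun i => (a.2.1 i : X)) = a.1.1 := by
      have h1 : LinearIndependent F (fun i => (a.2.1 i : X)) := a.2.2.map' a.1.1.subtype (by simp)
      refine Submodule.eq_of_le_of_finrank_eq
        (Submodule.span_le.2 (by rintro _ ⟨i, rfl⟩; exact (a.2.1 i).2)) ?_
      rw [finrank_span_eq_card h1, a.1.2.1, Fintype.card_fin]
    rintro ⟨⟨U, hU⟩, v⟩ ⟨⟨U', hU'⟩, v'⟩ h
    have h1 : (fun i => (v.1 i : X)) = fun i => (v'.1 i : X) := congrArg Subtype.val h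
    have : U = U' := by
      have e1 := span_eq ⟨⟨U, hU⟩, v⟩
      have e2 := span_eq ⟨⟨U', hU'⟩, v'⟩
      simp only at e1 e2
      rw [← e1, ← e2, h1]
    subst this
    congr 1
    ext i
    exact congrFun h1 i
  · rintro ⟨v, hv⟩
    have hv' : LinearIndependent F v := LinearIndependent.of_comp _ hv
    refine ⟨⟨⟨Submodule.span F (Set.range v), ?_, ?_⟩,
      ⟨fun i => ⟨v i, Submodule.subset_span ⟨i, rfl⟩⟩, ?_⟩⟩, rfl⟩
    · rw [finrank_span_eq_card hv', Fintype.card_fin]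
    · have := Submodule.range_ker_disjoint hv
      rwa [Submodule.ker_mkQ] at this
    · exact LinearIndependent.of_comp (Submodule.subtype _) hv'

/-- The number of `d`-dimensional subspaces that meet a given subspace `K` trivially. -/
theorem card_disjoint_submodule_mul [Finite X] (K : Submodule F X) (d : ℕ) :
    Nat.card {U : Submodule F X // Module.finrank F U = d ∧ Disjoint U K} *
        ∏ i ∈ Finset.range d, (Fintype.card F ^ d - Fintype.card F ^ i) =
      Nat.card K ^ d * ∏ i ∈ Finset.range d, (Nat.card (X ⧸ K) - Fintype.card F ^ i) := by
  -- Double count: ordered bases of subspaces avoiding K are the tuples independent modulo K.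
  have h := Nat.card_congr ((independentSpanEquiv K d).trans (liftIndependentEquiv K d))
  have : Finite (X ⧸ K) := Finite.of_surjective _ K.mkQ_surjective
  have := Fintype.ofFinite {U : Submodule F X // Module.finrank F U = d ∧ Disjoint U K}
  rw [Nat.card_sigma, Nat.card_prod, Nat.card_fun, Nat.card_fin,
    card_linearIndependent_eq_prod_range, mul_comm] at h
  rw [← h, Finset.sum_congr rfl (fun U _ => card_linearIndependent_eq_prod_range (F := F) d)]
  have hU (U : {U : Submodule F X // Module.finrank F U = d ∧ Disjoint U K}) :
      Nat.card U.1 = Fintype.card F ^ d := by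
    rw [Module.natCard_eq_pow_finrank (K := F), Nat.card_eq_fintype_card, U.2.1]
  simp only [hU, Finset.sum_const, smul_eq_mul, Finset.card_univ, Nat.card_eq_fintype_card]

end SubspaceCount

/-! ### Lattices: depth, the operation `up`, residual dimension -/

section PLattice

variable {V : Type*} [AddCommGroup V] {p n : ℕ}

/-- The subgroup `m V` of an additive commutative group `V`. -/
def multiples (V : Type*) [AddCommGroup V] (m : ℕ) : AddSubgroup V :=
  (nsmulAddMonoidHom m : V →+ V).range

/-- `V` has no `p`-torsion and `V / p V` has order `p ^ n`. -/
structure IsPFreeOfRank (p n : ℕ) (V : Type*) [AddCommGroup V] : Prop where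
  eq_zero_of_nsmul : ∀ x : V, p • x = 0 → x = 0
  index_multiples : (multiples V p).index = p ^ n

namespace AddSubgroup

/-- A subgroup is a `p`-lattice if it contains `p ^ k V` for some `k`. -/
def IsPLattice (p : ℕ) (L : AddSubgroup V) : Prop := ∃ k : ℕ, ∀ x : V, p ^ k • x ∈ L

/-- The least `k` such that `p ^ k V` lies in `L`. -/
noncomputable def depth (p : ℕ) (L : AddSubgroup V) : ℕ := sInf {k | ∀ x : V, p ^ k • x ∈ L}

/-- The subgroup of all `x` with `p x` in `L`. -/
def up (p : ℕ) (L : AddSubgroup V) : AddSubgroup V := L.comap (nsmulAddMonoidHom p)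

/-- The dimension of the image of `L` in `V / p V`. -/
noncomputable def resDim (p : ℕ) (L : AddSubgroup V) : ℕ :=
  padicValNat p ((multiples V p).relIndex L)

theorem mem_up {L : AddSubgroup V} {x : V} : x ∈ L.up p ↔ p • x ∈ L := Iff.rfl

theorem le_up (L : AddSubgroup V) : L ≤ L.up p := fun _ hx => L.nsmul_mem hx p

theorem nsmul_mem_iff_depth_le {L : AddSubgroup V} (hL : L.IsPLattice p) {k : ℕ} :
    (∀ x : V, p ^ k • x ∈ L) ↔ L.depth p ≤ k := by
  refine ⟨fun h => Nat.sInf_le h, fun h x => ?_⟩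
  obtain ⟨j, rfl⟩ := Nat.exists_eq_add_of_le h
  have h0 : ∀ x : V, p ^ L.depth p • x ∈ L := Nat.sInf_mem hL
  rw [pow_add, mul_smul]
  exact h0 _

theorem pow_depth_nsmul_mem {L : AddSubgroup V} (hL : L.IsPLattice p) (x : V) :
    p ^ L.depth p • x ∈ L := (nsmul_mem_iff_depth_le hL).2 le_rfl x

theorem depth_eq_zero_iff {L : AddSubgroup V} (hL : L.IsPLattice p) :
    L.depth p = 0 ↔ L = ⊤ := by
  rw [← Nat.le_zero, ← nsmul_mem_iff_depth_le hL, eq_top_iff']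
  simp

theorem isPLattice_top : (⊤ : AddSubgroup V).IsPLattice p := ⟨0, fun _ => mem_top _⟩

theorem depth_top : (⊤ : AddSubgroup V).depth p = 0 := (depth_eq_zero_iff isPLattice_top).2 rfl

theorem isPLattice_up_iff {L : AddSubgroup V} : (L.up p).IsPLattice p ↔ L.IsPLattice p := by
  refine ⟨fun ⟨k, hk⟩ => ⟨k + 1, fun x => ?_⟩, fun ⟨k, hk⟩ => ⟨k, fun x => le_up L (hk x)⟩⟩
  rw [pow_succ', mul_smul]
  exact hk x

/-- p^j V ⊆ up L is the same as p^(j+1) V ⊆ L. The whole group must be excluded because its depth 0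
cannot drop. -/
theorem depth_eq_depth_up_add_one {L : AddSubgroup V} (hL : L.IsPLattice p) (h : L ≠ ⊤) :
    L.depth p = (L.up p).depth p + 1 := by
  have h0 : L.depth p ≠ 0 := fun h' => h ((depth_eq_zero_iff hL).1 h')
  obtain ⟨k, hk⟩ := Nat.exists_eq_succ_of_ne_zero h0
  have key (j : ℕ) : (L.up p).depth p ≤ j ↔ L.depth p ≤ j + 1 := by
    rw [← nsmul_mem_iff_depth_le hL, ← nsmul_mem_iff_depth_le (isPLattice_up_iff.2 hL)]
    simp only [mem_up, pow_succ', mul_smul]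
  refine le_antisymm ((key _).1 le_rfl) ?_
  rw [hk, Nat.succ_eq_add_one, Nat.add_le_add_iff_right, key, hk]

end AddSubgroup

namespace IsPFreeOfRank

open AddSubgroup

variable (hV : IsPFreeOfRank p n V)
include hV

theorem nsmul_injective : Function.Injective (nsmulAddMonoidHom p : V →+ V) :=
  (injective_iff_map_eq_zero _).2 hV.eq_zero_of_nsmul

theorem index_map_nsmul (N : AddSubgroup V) :
    (N.map (nsmulAddMonoidHom p)).index = N.index * p ^ n := by
  have hle : N.map (nsmulAddMonoidHom p) ≤ multiples V p := by
    rintro _ ⟨x, -, rfl⟩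
    exact ⟨x, rfl⟩
  rw [← relIndex_mul_index hle, hV.index_multiples, multiples, AddMonoidHom.range_eq_map,
    relIndex_map_map_of_injective _ _ hV.nsmul_injective, relIndex_top_right]

theorem index_map_pow_nsmul (N : AddSubgroup V) (k : ℕ) :
    (N.map (nsmulAddMonoidHom (p ^ k))).index = N.index * p ^ (n * k) := by
  induction k with
  | zero =>
    have : (nsmulAddMonoidHom (p ^ 0) : V →+ V) = AddMonoidHom.id V := by ext; simp
    rw [this, AddSubgroup.map_id]
    simp
  | succ k ih =>
    have : (nsmulAddMonoidHom (p ^ (k + 1)) : V →+ V) =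
        (nsmulAddMonoidHom p).comp (nsmulAddMonoidHom (p ^ k)) := by
      ext x
      simp [pow_succ', mul_smul]
    rw [this, ← AddSubgroup.map_map, hV.index_map_nsmul, ih]
    ring

theorem index_multiples_pow (k : ℕ) : (multiples V (p ^ k)).index = p ^ (n * k) := by
  rw [multiples, AddMonoidHom.range_eq_map, hV.index_map_pow_nsmul, index_top, one_mul]

variable [hp : Fact p.Prime]

theorem exists_index_eq_pow {L : AddSubgroup V} (hL : L.IsPLattice p) :
    ∃ e, L.index = p ^ e := by
  obtain ⟨k, hk⟩ := hL
  have : multiples V (p ^ k) ≤ L := by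
    rintro _ ⟨x, rfl⟩
    exact hk x
  have h := index_dvd_of_le this
  rw [hV.index_multiples_pow, Nat.dvd_prime_pow hp.out] at h
  exact ⟨_, h.choose_spec.2⟩

theorem index_ne_zero {L : AddSubgroup V} (hL : L.IsPLattice p) : L.index ≠ 0 := by
  obtain ⟨e, he⟩ := hV.exists_index_eq_pow hL
  rw [he]
  exact pow_ne_zero _ hp.out.ne_zero

/-- The index [L : L ∩ pV] divides |V/pV| = p^n, so it is a power of p and the valuation in `resDim`
loses nothing. -/
theorem relIndex_multiples_eq (L : AddSubgroup V) :
    (multiples V p).relIndex L = p ^ L.resDim p := by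
  have h := relIndex_dvd_index_of_normal (multiples V p) L
  rw [hV.index_multiples, Nat.dvd_prime_pow hp.out] at h
  obtain ⟨e, -, he⟩ := h
  rw [resDim, he, padicValNat.prime_pow]

theorem resDim_le (L : AddSubgroup V) : L.resDim p ≤ n := by
  have h := relIndex_dvd_index_of_normal (multiples V p) L
  rwa [hV.index_multiples, hV.relIndex_multiples_eq,
    Nat.pow_dvd_pow_iff_le_right hp.out.one_lt] at h

theorem resDim_top : (⊤ : AddSubgroup V).resDim p = n := by
  rw [resDim, relIndex_top_right, hV.index_multiples, padicValNat.prime_pow]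

theorem relIndex_map_nsmul {N : AddSubgroup V} (hN : N.IsPLattice p) :
    (N.map (nsmulAddMonoidHom p)).relIndex N = p ^ n := by
  have hle : N.map (nsmulAddMonoidHom p) ≤ N := by
    rintro _ ⟨x, hx, rfl⟩
    exact N.nsmul_mem hx p
  have h := relIndex_mul_index hle
  rw [hV.index_map_nsmul, mul_comm] at h
  exact Nat.eq_of_mul_eq_mul_left (Nat.pos_of_ne_zero (hV.index_ne_zero hN)) h

omit hV hp in
theorem map_up_eq (L : AddSubgroup V) :
    (L.up p).map (nsmulAddMonoidHom p) = multiples V p ⊓ L := map_comap_eq _ _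

/-- In the chain p·up L = pV ∩ L ⊆ L ⊆ up L the total index is p^n and the lower step is p^(resDim
L), which leaves p^(n - resDim L) for the upper step. -/
theorem index_eq_index_up_mul {L : AddSubgroup V} (hL : L.IsPLattice p) :
    L.index = (L.up p).index * p ^ (n - L.resDim p) := by
  have h1 : (multiples V p ⊓ L).relIndex L * L.relIndex (L.up p) = p ^ n := by
    rw [relIndex_mul_relIndex _ _ _ inf_le_right (le_up L), ← map_up_eq,
      hV.relIndex_map_nsmul (isPLattice_up_iff.2 hL)]
  rw [inf_relIndex_right, hV.relIndex_multiples_eq] at h1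
  have h2 : L.relIndex (L.up p) = p ^ (n - L.resDim p) := by
    refine Nat.eq_of_mul_eq_mul_left (pow_pos hp.out.pos (L.resDim p)) ?_
    rw [h1, ← pow_add, Nat.add_sub_cancel' (hV.resDim_le L)]
  rw [← relIndex_mul_index (le_up (p := p) L), h2, mul_comm]

/-- A form of Nakayama's lemma: full residual dimension gives L and up L the same index, hence L =
up L, which contradicts the drop of depth unless L = V. -/
theorem resDim_eq_iff {L : AddSubgroup V} (hL : L.IsPLattice p) :
    L.resDim p = n ↔ L = ⊤ := by
  refine ⟨fun h => ?_, fun h => h ▸ hV.resDim_top⟩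
  by_contra hne
  have h1 := hV.index_eq_index_up_mul hL
  rw [h, Nat.sub_self, pow_zero, mul_one] at h1
  have h2 := relIndex_mul_index (le_up (p := p) L)
  rw [h1, Nat.mul_eq_right (hV.index_ne_zero (isPLattice_up_iff.2 hL)), relIndex_eq_one] at h2
  have h3 := depth_eq_depth_up_add_one hL hne
  rw [le_antisymm h2 (le_up L)] at h3
  omega

end IsPFreeOfRank

end PLattice

/-! ### The fibres of `up` as sets of subspaces -/

section Fibers

open AddSubgroup

variable {V : Type*} [AddCommGroup V] {p n : ℕ}

/-- The quotient `N / p N`. -/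
abbrev ModMultiples (p : ℕ) (N : AddSubgroup V) : Type _ := N ⧸ multiples N p

theorem nsmul_modMultiples (p : ℕ) (N : AddSubgroup V) (x : ModMultiples p N) : p • x = 0 := by
  obtain ⟨y, rfl⟩ := QuotientAddGroup.mk_surjective x
  rw [← QuotientAddGroup.mk_nsmul, QuotientAddGroup.eq_zero_iff]
  exact ⟨y, rfl⟩

noncomputable instance (p : ℕ) (N : AddSubgroup V) : Module (ZMod p) (ModMultiples p N) :=
  AddCommGroup.zmodModule (nsmul_modMultiples p N)

/-- The kernel of `N / p N → V / p V`. -/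
noncomputable def resKernel (p : ℕ) (N : AddSubgroup V) :
    Submodule (ZMod p) (ModMultiples p N) :=
  toZModSubmodule p (((multiples V p).addSubgroupOf N).map (QuotientAddGroup.mk' (multiples N p)))

theorem map_subtype_multiples (N : AddSubgroup V) :
    (multiples N p).map N.subtype = N.map (nsmulAddMonoidHom p) := by
  ext x
  constructor
  · rintro ⟨_, ⟨y, rfl⟩, rfl⟩
    exact ⟨y, y.2, rfl⟩
  · rintro ⟨y, hy, rfl⟩
    exact ⟨_, ⟨⟨y, hy⟩, rfl⟩, rfl⟩

variable (hV : IsPFreeOfRank p n V) [hp : Fact p.Prime]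
include hV

theorem card_modMultiples {N : AddSubgroup V} (hN : N.IsPLattice p) :
    Nat.card (ModMultiples p N) = p ^ n := by
  rw [← hV.relIndex_map_nsmul hN, ← AddSubgroup.index_eq_card, ← map_subtype_multiples,
    relIndex, addSubgroupOf, comap_map_eq_self_of_injective N.subtype_injective]

theorem isPFreeOfRank_of_isPLattice {N : AddSubgroup V} (hN : N.IsPLattice p) :
    IsPFreeOfRank p n N where
  eq_zero_of_nsmul x hx := Subtype.ext (hV.eq_zero_of_nsmul x (congrArg Subtype.val hx))
  index_multiples := card_modMultiples hV hN

omit hV hp in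
theorem multiples_le_multiples_addSubgroupOf (N : AddSubgroup V) :
    multiples N p ≤ (multiples V p).addSubgroupOf N := by
  rintro _ ⟨y, rfl⟩
  exact ⟨y, rfl⟩

theorem card_quotient_resKernel (N : AddSubgroup V) :
    Nat.card (ModMultiples p N ⧸ resKernel p N) = p ^ N.resDim p := by
  rw [← hV.relIndex_multiples_eq]
  change AddSubgroup.index (((multiples V p).addSubgroupOf N).map
    (QuotientAddGroup.mk' (multiples N p))) = _
  rw [index_map_eq _ (QuotientAddGroup.mk'_surjective _), relIndex]
  rw [QuotientAddGroup.ker_mk']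
  exact multiples_le_multiples_addSubgroupOf N

theorem card_resKernel {N : AddSubgroup V} (hN : N.IsPLattice p) :
    Nat.card (resKernel p N) = p ^ (n - N.resDim p) := by
  have h := Submodule.card_eq_card_quotient_mul_card (resKernel p N)
  rw [card_quotient_resKernel hV, card_modMultiples hV hN] at h
  refine Nat.eq_of_mul_eq_mul_left (pow_pos hp.out.pos (N.resDim p)) ?_
  rw [mul_comm, ← h, ← pow_add, Nat.add_sub_cancel' (hV.resDim_le N)]

/-- The subgroup of `V` that corresponds to a subspace of `N / p N`. -/
noncomputable def liftSubspace (N : AddSubgroup V) (U : Submodule (ZMod p) (ModMultiples p N)) :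
    AddSubgroup V :=
  (U.toAddSubgroup.comap (QuotientAddGroup.mk' (multiples N p))).map N.subtype

/-- The subspace of `N / p N` that corresponds to a subgroup of `V`. -/
noncomputable def imageSubspace (N L : AddSubgroup V) :
    Submodule (ZMod p) (ModMultiples p N) :=
  toZModSubmodule p ((L.addSubgroupOf N).map (QuotientAddGroup.mk' (multiples N p)))

omit hV in
theorem mem_liftSubspace {N : AddSubgroup V} {U : Submodule (ZMod p) (ModMultiples p N)} {x : V} :
    x ∈ liftSubspace N U ↔ ∃ h : x ∈ N, (QuotientAddGroup.mk ⟨x, h⟩ : ModMultiples p N) ∈ U := by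
  constructor
  · rintro ⟨y, hy, rfl⟩
    exact ⟨y.2, hy⟩
  · rintro ⟨h, hx⟩
    exact ⟨⟨x, h⟩, hx, rfl⟩

/-- If px lies in the lift of U, its class is in U and, being in pV, also in the kernel of
reduction. So px ∈ pN, and cancelling p gives x ∈ N. Conversely p kills N/pN. -/
theorem up_liftSubspace {N : AddSubgroup V} {U : Submodule (ZMod p) (ModMultiples p N)}
    (hU : Disjoint U (resKernel p N)) : (liftSubspace N U).up p = N := by
  ext x
  rw [mem_up, mem_liftSubspace]
  constructor
  · rintro ⟨h, hx⟩
    have hK : (QuotientAddGroup.mk ⟨p • x, h⟩ : ModMultiples p N) ∈ resKernel p N :=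
      ⟨⟨p • x, h⟩, ⟨x, rfl⟩, rfl⟩
    have h0 := Submodule.disjoint_def.1 hU _ hx hK
    rw [QuotientAddGroup.eq_zero_iff] at h0
    obtain ⟨y, hy⟩ := h0
    have : (y : V) = x := hV.nsmul_injective (congrArg Subtype.val hy)
    exact this ▸ y.2
  · intro hx
    refine ⟨N.nsmul_mem hx p, ?_⟩
    convert U.zero_mem
    rw [QuotientAddGroup.eq_zero_iff]
    exact ⟨⟨x, hx⟩, rfl⟩

omit hV hp in
theorem multiples_le_addSubgroupOf {L N : AddSubgroup V} (h : L.up p = N) :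
    multiples N p ≤ L.addSubgroupOf N := by
  subst h
  rintro _ ⟨y, rfl⟩
  exact y.2

omit hV in
theorem liftSubspace_imageSubspace {L N : AddSubgroup V} (h : L.up p = N) :
    liftSubspace N (imageSubspace (p := p) N L) = L := by
  ext x
  rw [mem_liftSubspace]
  constructor
  · rintro ⟨hx, ⟨y, hy, hxy⟩⟩
    have h1 := multiples_le_addSubgroupOf h ((QuotientAddGroup.eq).1 hxy)
    have := (L.addSubgroupOf N).add_mem hy h1
    rwa [add_neg_cancel_left] at this
  · intro hx
    have hN : x ∈ N := h ▸ le_up L hx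
    exact ⟨hN, ⟨⟨x, hN⟩, hx, rfl⟩⟩

omit hV in
theorem imageSubspace_liftSubspace (N : AddSubgroup V)
    (U : Submodule (ZMod p) (ModMultiples p N)) :
    imageSubspace (p := p) N (liftSubspace N U) = U := by
  ext x
  constructor
  · rintro ⟨y, hy, rfl⟩
    obtain ⟨h, hy'⟩ := mem_liftSubspace.1 (show (y : V) ∈ liftSubspace N U from hy)
    exact hy'
  · intro hx
    obtain ⟨y, rfl⟩ := QuotientAddGroup.mk_surjective x
    exact ⟨y, mem_liftSubspace.2 ⟨y.2, hx⟩, rfl⟩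

omit hV in
theorem disjoint_imageSubspace {L N : AddSubgroup V} (h : L.up p = N) :
    Disjoint (imageSubspace (p := p) N L) (resKernel p N) := by
  rw [Submodule.disjoint_def]
  rintro _ ⟨y, hy, rfl⟩ ⟨z, hz, hzy⟩
  have h1 := multiples_le_multiples_addSubgroupOf N ((QuotientAddGroup.eq).1 hzy)
  have h2 := ((multiples V p).addSubgroupOf N).add_mem hz h1
  rw [add_neg_cancel_left] at h2
  obtain ⟨x, hx⟩ := h2
  refine (QuotientAddGroup.eq_zero_iff _).2 ?_
  have hxN : x ∈ N := by
    rw [← h, mem_up]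
    change p • x = y at hx
    rw [hx]
    exact hy
  exact ⟨⟨x, hxN⟩, Subtype.ext hx⟩

/-- The image of L in N/pN is L/pN, and pN = p·up L = pV ∩ L. -/
theorem card_imageSubspace {L N : AddSubgroup V} (h : L.up p = N) :
    Nat.card (imageSubspace (p := p) N L) = p ^ L.resDim p := by
  change Nat.card ((L.addSubgroupOf N).map (QuotientAddGroup.mk' (multiples N p))) = _
  rw [← hV.relIndex_multiples_eq, ← inf_relIndex_right, ← IsPFreeOfRank.map_up_eq, h,
    ← relIndex_ker, QuotientAddGroup.ker_mk', ← relIndex_map_map_of_injective _ _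
    N.subtype_injective, map_subtype_multiples]
  congr 1
  exact map_addSubgroupOf_eq_of_le (h ▸ le_up L)

/-- The subgroups `L` with `up L = N` correspond to subspaces of `N / p N` that meet the kernel of
reduction trivially. -/
noncomputable def upFiberEquiv {N : AddSubgroup V} (hN : N.IsPLattice p) (d : ℕ) :
    {L : AddSubgroup V // L.up p = N ∧ L.resDim p = d} ≃
      {U : Submodule (ZMod p) (ModMultiples p N) //
        Module.finrank (ZMod p) U = d ∧ Disjoint U (resKernel p N)} :=
  have hfin : Finite (ModMultiples p N) := Nat.finite_of_card_ne_zero (by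
    rw [card_modMultiples hV hN]; exact pow_ne_zero _ hp.out.ne_zero)
  have key (L : AddSubgroup V) (h : L.up p = N) :
      Module.finrank (ZMod p) (imageSubspace (p := p) N L) = L.resDim p := by
    have h1 := card_imageSubspace hV h
    rw [Module.natCard_eq_pow_finrank (K := ZMod p), Nat.card_zmod] at h1
    exact Nat.pow_right_injective hp.out.two_le h1
  { toFun := fun L => ⟨imageSubspace N L.1,
      (key L.1 L.2.1).trans L.2.2, disjoint_imageSubspace L.2.1⟩
    invFun := fun U => ⟨liftSubspace N U.1, up_liftSubspace hV U.2.2, by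
      have h := key (liftSubspace N U.1) (up_liftSubspace hV U.2.2)
      rw [imageSubspace_liftSubspace, U.2.1] at h
      exact h.symm⟩
    left_inv := fun L => Subtype.ext (liftSubspace_imageSubspace L.2.1)
    right_inv := fun U => Subtype.ext (imageSubspace_liftSubspace N U.1) }

theorem finite_upFiber {N : AddSubgroup V} (hN : N.IsPLattice p) (d : ℕ) :
    Finite {L : AddSubgroup V // L.up p = N ∧ L.resDim p = d} := by
  have : Finite (ModMultiples p N) := Nat.finite_of_card_ne_zero (by
    rw [card_modMultiples hV hN]; exact pow_ne_zero _ hp.out.ne_zero)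
  exact Finite.of_equiv _ (upFiberEquiv hV hN d).symm

theorem card_upFiber_mul {N : AddSubgroup V} (hN : N.IsPLattice p) (d : ℕ) :
    Nat.card {L : AddSubgroup V // L.up p = N ∧ L.resDim p = d} *
        ∏ i ∈ Finset.range d, (p ^ d - p ^ i) =
      p ^ ((n - N.resDim p) * d) * ∏ i ∈ Finset.range d, (p ^ N.resDim p - p ^ i) := by
  have : Finite (ModMultiples p N) := Nat.finite_of_card_ne_zero (by
    rw [card_modMultiples hV hN]; exact pow_ne_zero _ hp.out.ne_zero)
  have h := card_disjoint_submodule_mul (resKernel p N) d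
  rw [card_resKernel hV hN, card_quotient_resKernel hV, ZMod.card, ← pow_mul] at h
  rw [Nat.card_congr (upFiberEquiv hV hN d), h]

end Fibers

/-! ### Sums over lattices of fixed depth -/

section Levels

open AddSubgroup

variable {V : Type*} [AddCommGroup V] {p n : ℕ}

/-- The number of lattices `L` with `resDim L = d` and given `up L` of residual dimension `w`. -/
def upFiberCard (p n w d : ℕ) : ℕ :=
  p ^ ((n - w) * d) * (∏ i ∈ Finset.range d, (p ^ w - p ^ i)) /
    ∏ i ∈ Finset.range d, (p ^ d - p ^ i)

theorem prod_pow_sub_pow_pos (hp : p.Prime) (d : ℕ) :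
    0 < ∏ i ∈ Finset.range d, (p ^ d - p ^ i) :=
  Finset.prod_pos fun _ hi =>
    Nat.sub_pos_of_lt (Nat.pow_lt_pow_right hp.one_lt (Finset.mem_range.1 hi))

theorem upFiberCard_eq_zero {w d : ℕ} (h : w < d) : upFiberCard p n w d = 0 := by
  have : ∏ i ∈ Finset.range d, (p ^ w - p ^ i) = 0 :=
    Finset.prod_eq_zero (Finset.mem_range.2 h) (Nat.sub_self _)
  rw [upFiberCard, this, mul_zero, Nat.zero_div]

variable (hV : IsPFreeOfRank p n V) [hp : Fact p.Prime]
include hV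

theorem card_upFiber {N : AddSubgroup V} (hN : N.IsPLattice p) (d : ℕ) :
    Nat.card {L : AddSubgroup V // L.up p = N ∧ L.resDim p = d} =
      upFiberCard p n (N.resDim p) d := by
  rw [upFiberCard, ← card_upFiber_mul hV hN d,
    Nat.mul_div_cancel _ (prod_pow_sub_pow_pos hp.out d)]

theorem finite_level (k : ℕ) :
    {L : AddSubgroup V | L.IsPLattice p ∧ L.depth p = k}.Finite := by
  induction k with
  | zero =>
    refine (Set.finite_singleton ⊤).subset ?_
    rintro L ⟨hL, h0⟩
    exact (depth_eq_zero_iff hL).1 h0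
  | succ k ih =>
    refine (ih.biUnion (t := fun N => ⋃ d ∈ Set.Iic n,
      {L : AddSubgroup V | L.up p = N ∧ L.resDim p = d}) fun N hN =>
        (Set.finite_Iic n).biUnion fun d _ => finite_upFiber hV hN.1 d).subset ?_
    rintro L ⟨hL, h⟩
    have hne : L ≠ ⊤ := fun h' => by rw [h', depth_top] at h; omega
    have := depth_eq_depth_up_add_one hL hne
    simp only [Set.mem_iUnion, Set.mem_ofPred_eq]
    exact ⟨L.up p, ⟨isPLattice_up_iff.2 hL, by omega⟩, L.resDim p, hV.resDim_le L, rfl, rfl⟩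

/-- The lattices of depth `k`. -/
noncomputable def level (k : ℕ) : Finset (AddSubgroup V) := (finite_level hV k).toFinset

theorem mem_level {k : ℕ} {L : AddSubgroup V} :
    L ∈ level hV k ↔ L.IsPLattice p ∧ L.depth p = k := by
  simp [level]

-- The bound d < n rules out L = V, the one lattice whose depth does not exceed that of its `up`.
omit hV in
theorem mem_upFiber_succ {k d : ℕ} (hd : d < n) (hV : IsPFreeOfRank p n V) {N L : AddSubgroup V}
    (hN : N ∈ level hV k) :
    (L ∈ level hV (k + 1) ∧ L.resDim p = d) ∧ L.up p = N ↔ L.up p = N ∧ L.resDim p = d := by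
  rw [mem_level] at hN
  rw [mem_level]
  refine ⟨fun h => ⟨h.2, h.1.2⟩, fun ⟨h1, h2⟩ => ⟨⟨?_, h2⟩, h1⟩⟩
  have hL : L.IsPLattice p := isPLattice_up_iff.1 (h1 ▸ hN.1)
  refine ⟨hL, ?_⟩
  rw [depth_eq_depth_up_add_one hL, h1, hN.2]
  intro h
  rw [← hV.resDim_eq_iff hL] at h
  omega

variable {K : Type*} [CommRing K] (u : K)

/-- The sum of `u ^ e` over the lattices of index `p ^ e`, of depth `k` and of residual
dimension `d`. -/
noncomputable def levelSum (k d : ℕ) : K := by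
  classical
  exact ∑ L ∈ (level hV k).filter (fun L => L.resDim p = d), u ^ padicValNat p L.index

theorem levelSum_zero (d : ℕ) : levelSum hV u 0 d = if d = n then 1 else 0 := by
  classical
  have : level hV 0 = {⊤} := by
    ext L
    rw [mem_level, Finset.mem_singleton]
    exact ⟨fun h => (depth_eq_zero_iff h.1).1 h.2, fun h => h ▸ ⟨isPLattice_top, depth_top⟩⟩
  rw [levelSum, this, Finset.filter_singleton, hV.resDim_top]
  simp only [eq_comm (a := n)]
  split_ifs
  · simp
  · simp

theorem levelSum_succ_self (k : ℕ) : levelSum hV u (k + 1) n = 0 := by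
  classical
  rw [levelSum, Finset.filter_eq_empty_iff.2, Finset.sum_empty]
  intro L hL
  rw [mem_level] at hL
  rw [hV.resDim_eq_iff hL.1]
  rintro rfl
  rw [depth_top] at hL
  omega

/-- Group the lattices by N = up L. Over a fixed N each L has weight u^(n-d) times the weight of N,
and the number of such L depends on N only through its residual dimension w. -/
theorem levelSum_succ {k d : ℕ} (hd : d < n) :
    levelSum hV u (k + 1) d =
      u ^ (n - d) * ∑ w ∈ Finset.range (n + 1), (upFiberCard p n w d : K) * levelSum hV u k w := by
  classical
  have hmaps : ∀ L ∈ (level hV (k + 1)).filter (fun L => L.resDim p = d),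
      L.up p ∈ level hV k := by
    intro L hL
    rw [Finset.mem_filter, mem_level] at hL
    rw [mem_level]
    refine ⟨isPLattice_up_iff.2 hL.1.1, ?_⟩
    have hne : L ≠ ⊤ := by
      rw [Ne, ← hV.resDim_eq_iff hL.1.1]
      omega
    have := depth_eq_depth_up_add_one hL.1.1 hne
    omega
  have hinner : ∀ N ∈ level hV k,
      ∑ L ∈ ((level hV (k + 1)).filter (fun L => L.resDim p = d)).filter (fun L => L.up p = N),
        u ^ padicValNat p L.index =
      u ^ (n - d) * ((upFiberCard p n (N.resDim p) d : K) * u ^ padicValNat p N.index) := by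
    intro N hN
    have hN' := (mem_level hV).1 hN
    rw [Finset.sum_congr rfl (g := fun _ => u ^ (n - d) * u ^ padicValNat p N.index),
      Finset.sum_const, nsmul_eq_mul]
    · have hcard : ((level hV (k + 1)).filter (fun L => L.resDim p = d)).filter
          (fun L => L.up p = N) = {L : AddSubgroup V | L.up p = N ∧ L.resDim p = d} := by
        ext L
        simp only [Finset.coe_filter, Set.mem_ofPred_eq, Finset.mem_filter]
        exact mem_upFiber_succ hd hV hN
      rw [← Set.ncard_coe_finset, hcard, ← card_upFiber hV hN'.1 d, ← Nat.card_coe_set_eq]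
      simp only [Set.coe_ofPred]
      ring
    · intro L hL
      rw [Finset.mem_filter, Finset.mem_filter, mem_upFiber_succ hd hV hN] at hL
      have hL' : L.IsPLattice p := isPLattice_up_iff.1 (hL.1 ▸ hN'.1)
      rw [hV.index_eq_index_up_mul hL', hL.1, hL.2,
        padicValNat.mul (hV.index_ne_zero hN'.1) (pow_ne_zero _ hp.out.ne_zero),
        padicValNat.prime_pow, pow_add, mul_comm]
  rw [levelSum, ← Finset.sum_fiberwise_of_maps_to hmaps, Finset.sum_congr rfl hinner,
    ← Finset.mul_sum]
  congr 1
  rw [← Finset.sum_fiberwise_of_maps_to (g := fun N : AddSubgroup V => N.resDim p)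
    (t := Finset.range (n + 1)) fun N _ => Finset.mem_range.2 (Nat.lt_succ_of_le (hV.resDim_le N))]
  refine Finset.sum_congr rfl fun w _ => ?_
  rw [levelSum, Finset.mul_sum]
  refine Finset.sum_congr rfl fun N hN => ?_
  rw [(Finset.mem_filter.1 hN).2]

theorem sum_level_eq (k : ℕ) :
    ∑ L ∈ level hV k, u ^ padicValNat p L.index =
      ∑ d ∈ Finset.range (n + 1), levelSum hV u k d := by
  classical
  rw [← Finset.sum_fiberwise_of_maps_to (g := fun N : AddSubgroup V => N.resDim p)
    (t := Finset.range (n + 1)) fun N _ => Finset.mem_range.2 (Nat.lt_succ_of_le (hV.resDim_le N))]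
  rfl

end Levels

/-! ### Summability from a triangular recursion -/

section Recursion

/-- The partial sums satisfy S ≤ xS + ∑ e + b 0, so they are bounded by (b 0 + ∑ e)/(1 - x). -/
theorem summable_of_succ_eq_mul_add {b e : ℕ → ℝ} {x : ℝ} (hb : ∀ k, 0 ≤ b k)
    (he0 : ∀ k, 0 ≤ e k) (he : Summable e) (hx : x < 1)
    (h : ∀ k, b (k + 1) = x * b k + e k) : Summable b := by
  refine summable_of_sum_range_le (c := (b 0 + ∑' k, e k) / (1 - x)) hb fun m => ?_
  have hS : ∑ k ∈ Finset.range m, b k ≤ ∑ k ∈ Finset.range (m + 1), b k := by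
    rw [Finset.sum_range_succ]
    exact le_add_of_nonneg_right (hb m)
  have h1 : ∑ k ∈ Finset.range (m + 1), b k =
      x * ∑ k ∈ Finset.range m, b k + ∑ k ∈ Finset.range m, e k + b 0 := by
    rw [Finset.sum_range_succ', Finset.sum_congr rfl fun k _ => h k, Finset.sum_add_distrib,
      Finset.mul_sum]
  have h2 := he.sum_le_tsum (Finset.range m) fun k _ => he0 k
  rw [le_div_iff₀ (by linarith)]
  linarith

/-- Downward induction on d from n: the terms with w > d form a summable inhomogeneity, and the
diagonal term is a contraction by y d * c d d. -/
theorem summable_of_triangular_recursion {n : ℕ} {b c : ℕ → ℕ → ℝ} {y : ℕ → ℝ}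
    (hb : ∀ k d, 0 ≤ b k d) (hc0 : ∀ w d, 0 ≤ c w d) (hc : ∀ w d, w < d → c w d = 0)
    (hy0 : ∀ d, 0 ≤ y d) (hy : ∀ d < n, y d * c d d < 1) (hn : ∀ k, b (k + 1) n = 0)
    (hrec : ∀ k, ∀ d < n, b (k + 1) d = y d * ∑ w ∈ Finset.range (n + 1), c w d * b k w)
    {d : ℕ} (hd : d ≤ n) : Summable fun k => b k d := by
  induction d using Nat.strong_decreasing_induction with
  | base => exact ⟨n, fun m hm h => absurd h (by omega)⟩
  | step d ih =>
    rcases hd.eq_or_lt with rfl | hlt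
    · rw [← summable_nat_add_iff 1]
      simp only [hn]
      exact summable_zero
    · refine summable_of_succ_eq_mul_add (x := y d * c d d)
        (e := fun k => y d * ∑ w ∈ Finset.Ioc d n, c w d * b k w) (fun k => hb k d)
        (fun k => mul_nonneg (hy0 d) (Finset.sum_nonneg fun w _ => mul_nonneg (hc0 w d) (hb k w)))
        ?_ (hy d hlt) fun k => ?_
      · refine Summable.mul_left _ (summable_sum fun w hw => Summable.mul_left _ ?_)
        rw [Finset.mem_Ioc] at hw
        exact ih w hw.1 hw.2
      · rw [hrec k d hlt, mul_assoc, ← mul_add]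
        congr 1
        rw [← Finset.sum_subset (s₁ := Finset.Icc d n)]
        · rw [← Finset.sum_Ioc_add_eq_sum_Icc hd, add_comm]
        · intro w hw
          rw [Finset.mem_Icc] at hw
          exact Finset.mem_range.2 (by omega)
        · intro w hw hw'
          rw [Finset.mem_range] at hw
          rw [Finset.mem_Icc] at hw'
          rw [hc w d (by omega), zero_mul]

end Recursion

/-! ### Gaussian binomials and sums over chains -/

section GaussBinom

variable {K : Type*} [Field K]

theorem gaussBinom_zero_right (Y : K) (a : ℕ) : gaussBinom Y a 0 = 1 := by
  simp [gaussBinom]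

theorem gaussMultinomial_insert (Y : K) (a b : ℕ) {I : Finset ℕ} (hI : ∀ i ∈ I, i < b) :
    gaussMultinomial Y a (insert b I) = gaussBinom Y a b * gaussMultinomial Y b I := by
  rw [gaussMultinomial, Finset.sort_insert _ (fun i hi => (hI i hi).le)
    (fun h => lt_irrefl b (hI b h))]
  rfl

/-- The sum over all `I ⊆ {1, …, b}` of `binom(a, I)_Y ∏_{i ∈ I} z i`. -/
noncomputable def multinomialSum (Y : K) (z : ℕ → K) (a b : ℕ) : K :=
  ∑ I ∈ (Finset.Icc 1 b).powerset, gaussMultinomial Y a I * ∏ i ∈ I, z i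

theorem multinomialSum_succ (Y : K) (z : ℕ → K) (a b : ℕ) :
    multinomialSum Y z a (b + 1) = multinomialSum Y z a b +
      gaussBinom Y a (b + 1) * z (b + 1) * multinomialSum Y z (b + 1) b := by
  have hIcc : Finset.Icc 1 (b + 1) = insert (b + 1) (Finset.Icc 1 b) := by
    ext i
    simp only [Finset.mem_insert, Finset.mem_Icc]
    omega
  have hnot : b + 1 ∉ Finset.Icc 1 b := by simp
  rw [multinomialSum, hIcc, Finset.sum_powerset_insert hnot]
  congr 1
  rw [multinomialSum, Finset.mul_sum]
  refine Finset.sum_congr rfl fun I hI => ?_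
  have hI' : ∀ i ∈ I, i < b + 1 := fun i hi => by
    have := Finset.mem_Icc.1 (Finset.mem_powerset.1 hI hi)
    omega
  rw [gaussMultinomial_insert Y a (b + 1) hI',
    Finset.prod_insert fun h => hnot (Finset.mem_powerset.1 hI h)]
  ring

/-- The sets I are sorted by their largest element j + 1; the term 1 is the empty set. -/
theorem multinomialSum_eq (Y : K) (z : ℕ → K) (a b : ℕ) :
    multinomialSum Y z a b = 1 +
      ∑ j ∈ Finset.range b,
        gaussBinom Y a (j + 1) * z (j + 1) * multinomialSum Y z (j + 1) j := by
  induction b with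
  | zero => simp [multinomialSum, gaussMultinomial, gaussChain]
  | succ b ih => rw [multinomialSum_succ, ih, Finset.sum_range_succ, add_assoc]

/-- Summing the solution of the triangular system over all chains. -/
theorem sum_eq_multinomialSum {n : ℕ} (hn : 0 < n) (Y : K) (z G : ℕ → K) (hGn : G n = 1)
    (hG : ∀ d < n, G d = z d * ∑ w ∈ Finset.Ioc d n, G w * gaussBinom Y w d) :
    ∑ d ∈ Finset.range (n + 1), G d = (1 + z 0) * multinomialSum Y z n (n - 1) := by
  -- F a is the sum over all chains below a, with 0 allowed as last member. Adjoining 0 costs no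
  -- binomial, hence the factor 1 + z 0, which is absent for a = 0.
  set F : ℕ → K := fun a => if a = 0 then 1 else (1 + z 0) * multinomialSum Y z a (a - 1) with hF
  have hFrec (a : ℕ) : F a = 1 + ∑ j ∈ Finset.range a, gaussBinom Y a j * z j * F j := by
    rcases a with _ | a
    · simp [hF]
    · rw [Finset.sum_range_succ', gaussBinom_zero_right]
      simp only [hF, if_true, Nat.succ_ne_zero, if_false, Nat.add_sub_cancel]
      rw [multinomialSum_eq, mul_add, Finset.mul_sum]
      simp only [mul_left_comm (1 + z 0)]
      ring
  -- Write each G w as G w times (F w minus its recursion). After exchanging the sums, the recursion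
  -- of G turns the subtracted part into ∑ G j F j over j < n, and only G n F n survives.
  have h1 : ∑ w ∈ Finset.range (n + 1), G w =
      ∑ w ∈ Finset.range (n + 1), G w * F w -
        ∑ w ∈ Finset.range (n + 1), ∑ j ∈ Finset.range w,
          G w * (gaussBinom Y w j * z j * F j) := by
    rw [← Finset.sum_sub_distrib]
    refine Finset.sum_congr rfl fun w _ => ?_
    rw [← Finset.mul_sum, ← mul_sub]
    conv_rhs => rw [hFrec w]
    rw [add_sub_cancel_right, mul_one]
  have h2 : ∑ w ∈ Finset.range (n + 1), ∑ j ∈ Finset.range w,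
      G w * (gaussBinom Y w j * z j * F j) = ∑ j ∈ Finset.range n, G j * F j := by
    rw [Finset.sum_comm' (t' := Finset.range n) (s' := fun j => Finset.Ioc j n)]
    · refine Finset.sum_congr rfl fun j hj => ?_
      rw [hG j (Finset.mem_range.1 hj), Finset.mul_sum, Finset.sum_mul]
      exact Finset.sum_congr rfl fun w _ => by ring
    · intro w j
      simp only [Finset.mem_range, Finset.mem_Ioc]
      omega
  rw [h1, h2, Finset.sum_range_succ, add_sub_cancel_left, hGn, one_mul]
  simp [hF, hn.ne']

/-- Pulling p^m out of each factor p^m - p^i converts both products to powers of 1/p. The exponents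
combine by (n-w)d + wd = d(n-d) + d². The divisibility hypothesis makes the division of naturals
exact. -/
theorem cast_upFiberCard [CharZero K] {p n w d : ℕ} (hp : p.Prime) (hdw : d ≤ w) (hwn : w ≤ n)
    (hdvd : (∏ i ∈ Finset.range d, (p ^ d - p ^ i)) ∣
      p ^ ((n - w) * d) * ∏ i ∈ Finset.range d, (p ^ w - p ^ i)) :
    (upFiberCard p n w d : K) = (p : K) ^ (d * (n - d)) * gaussBinom (p : K)⁻¹ w d := by
  have hp0 : (p : K) ≠ 0 := Nat.cast_ne_zero.2 hp.ne_zero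
  have key (m : ℕ) (hm : d ≤ m) : ((∏ i ∈ Finset.range d, (p ^ m - p ^ i) : ℕ) : K) =
      (p : K) ^ (m * d) * ∏ i ∈ Finset.Icc (m - d + 1) m, (1 - (p : K)⁻¹ ^ i) := by
    have hIcc : ∏ i ∈ Finset.Icc (m - d + 1) m, (1 - (p : K)⁻¹ ^ i) =
        ∏ i ∈ Finset.range d, (1 - (p : K)⁻¹ ^ (m - i)) := by
      refine (Finset.prod_bij (fun i _ => m - i) ?_ ?_ ?_ ?_).symm
      · intro i hi
        rw [Finset.mem_range] at hi
        rw [Finset.mem_Icc]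
        omega
      · intro i hi j hj h
        rw [Finset.mem_range] at hi hj
        omega
      · intro i hi
        rw [Finset.mem_Icc] at hi
        exact ⟨m - i, Finset.mem_range.2 (by omega), by omega⟩
      · intro i _
        rfl
    have hpow : (p : K) ^ (m * d) = ∏ i ∈ Finset.range d, (p : K) ^ m := by
      rw [Finset.prod_const, Finset.card_range, pow_mul]
    rw [hIcc, hpow, ← Finset.prod_mul_distrib, Nat.cast_prod]
    refine Finset.prod_congr rfl fun i hi => ?_
    have him : i ≤ m := (Finset.mem_range.1 hi).le.trans hm
    have hpm : (p : K) ^ m * (p : K)⁻¹ ^ (m - i) = (p : K) ^ i := by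
      rw [inv_pow, mul_inv_eq_iff_eq_mul₀ (pow_ne_zero _ hp0), ← pow_add, Nat.add_sub_cancel' him]
    rw [Nat.cast_sub (Nat.pow_le_pow_right hp.pos him), mul_sub, mul_one, hpm]
    push_cast
    rfl
  have hne : (∏ i ∈ Finset.Icc 1 d, (1 - (p : K)⁻¹ ^ i)) ≠ 0 := by
    have h := key d le_rfl
    rw [Nat.sub_self, zero_add] at h
    intro h0
    rw [h0, mul_zero, Nat.cast_eq_zero] at h
    exact (prod_pow_sub_pow_pos hp d).ne' h
  rw [upFiberCard, Nat.cast_div hdvd (Nat.cast_ne_zero.2 (prod_pow_sub_pow_pos hp d).ne'),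
    Nat.cast_mul, key w hdw, key d le_rfl, Nat.sub_self, zero_add, gaussBinom]
  have he : (n - w) * d + w * d = d * (n - d) + d * d := by
    rw [← add_mul, Nat.sub_add_cancel hwn, mul_comm d (n - d), ← add_mul,
      Nat.sub_add_cancel (hdw.trans hwn)]
  have he' : (p : K) ^ ((n - w) * d) * (p : K) ^ (w * d) =
      (p : K) ^ (d * (n - d)) * (p : K) ^ (d * d) := by rw [← pow_add, he, pow_add]
  push_cast
  rw [← mul_assoc, he', mul_assoc, mul_left_comm, mul_div_mul_left _ _ (pow_ne_zero _ hp0),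
    mul_div_assoc]

end GaussBinom

/-! ### The generating function of lattices by index and depth -/

section LatticeSum

open AddSubgroup

variable {V : Type*} [AddCommGroup V] {p n : ℕ}

/-- The type of `p`-lattices in `V`. -/
abbrev PLattice (p : ℕ) (V : Type*) [AddCommGroup V] : Type _ :=
  {L : AddSubgroup V // L.IsPLattice p}

theorem upFiberCard_self (hp : p.Prime) (d : ℕ) : upFiberCard p n d d = p ^ (d * (n - d)) := by
  rw [upFiberCard, Nat.mul_div_cancel _ (prod_pow_sub_pow_pos hp d), mul_comm]

variable (hV : IsPFreeOfRank p n V) [hp : Fact p.Prime]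
include hV

/-- The quotient counts a fibre of `up`, so divisibility comes for free as soon as some lattice has
residual dimension w. -/
theorem prod_dvd_upFiberCard {w : ℕ} (N : AddSubgroup V) (hN : N.IsPLattice p)
    (hw : N.resDim p = w) (d : ℕ) :
    (∏ i ∈ Finset.range d, (p ^ d - p ^ i)) ∣
      p ^ ((n - w) * d) * ∏ i ∈ Finset.range d, (p ^ w - p ^ i) :=
  ⟨_, by rw [← hw, ← card_upFiber_mul hV hN d, mul_comm]⟩

/-- Lattices of depth `k` as members of `level`. -/
noncomputable def depthFiberEquiv (k : ℕ) :
    {L : PLattice p V // L.1.depth p = k} ≃ (level hV k : Set (AddSubgroup V)) where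
  toFun L := ⟨L.1.1, (mem_level hV).2 ⟨L.1.2, L.2⟩⟩
  invFun L := ⟨⟨L.1, ((mem_level hV).1 L.2).1⟩, ((mem_level hV).1 L.2).2⟩
  left_inv _ := rfl
  right_inv _ := rfl

theorem finite_depthFiber (k : ℕ) : Finite {L : PLattice p V // L.1.depth p = k} :=
  Finite.of_equiv _ (depthFiberEquiv hV k).symm

theorem tsum_depthFiber {E : Type*} [NormedAddCommGroup E] (g : AddSubgroup V → E) (k : ℕ) :
    ∑' L : {L : PLattice p V // L.1.depth p = k}, g L.1.1 = ∑ L ∈ level hV k, g L := by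
  rw [← Finset.tsum_subtype', ← (depthFiberEquiv hV k).tsum_eq]
  rfl

theorem levelSum_nonneg {u : ℝ} (hu : 0 ≤ u) (k d : ℕ) : 0 ≤ levelSum hV u k d :=
  Finset.sum_nonneg fun _ _ => pow_nonneg hu _

theorem norm_levelSum_le (u : ℂ) (k d : ℕ) :
    ‖levelSum hV u k d‖ ≤ levelSum hV ‖u‖ k d :=
  (norm_sum_le _ _).trans_eq (Finset.sum_congr rfl fun _ _ => norm_pow _ _)

variable {u v : ℂ}

theorem summable_levelSum_norm
    (h : ∀ d < n, ‖(p : ℂ) ^ (d * (n - d)) * (u ^ (n - d) * v)‖ < 1) {d : ℕ} (hd : d ≤ n) :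
    Summable fun k => ‖v‖ ^ k * levelSum hV ‖u‖ k d := by
  refine summable_of_triangular_recursion (n := n) (c := fun w d => (upFiberCard p n w d : ℝ))
    (b := fun k d => ‖v‖ ^ k * levelSum hV ‖u‖ k d)
    (y := fun d => ‖u‖ ^ (n - d) * ‖v‖)
    (fun k d => mul_nonneg (by positivity) (levelSum_nonneg hV (norm_nonneg u) k d))
    (fun w d => by positivity) (fun w d hwd => ?_) (fun d => by positivity) (fun d hdn => ?_)
    (fun k => ?_) (fun k d hdn => ?_) hd
  · rw [upFiberCard_eq_zero hwd, Nat.cast_zero]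
  · rw [upFiberCard_self hp.out]
    have := h d hdn
    simp only [norm_mul, norm_pow, Complex.norm_natCast] at this
    push_cast
    linarith
  · rw [levelSum_succ_self, mul_zero]
  · rw [levelSum_succ hV _ hdn, Finset.mul_sum, Finset.mul_sum, Finset.mul_sum]
    exact Finset.sum_congr rfl fun w _ => by ring

theorem summable_norm_lattice
    (h : ∀ d < n, ‖(p : ℂ) ^ (d * (n - d)) * (u ^ (n - d) * v)‖ < 1) :
    Summable fun L : PLattice p V =>
      ‖u ^ padicValNat p L.1.index * v ^ L.1.depth p‖ := by
  rw [← (Equiv.sigmaFiberEquiv fun L : PLattice p V => L.1.depth p).summable_iff]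
  have := fun k => finite_depthFiber hV k
  refine (summable_sigma_of_nonneg
    (f := fun c : (Σ k, {L : PLattice p V // L.1.depth p = k}) =>
      ‖u ^ padicValNat p c.2.1.1.index * v ^ c.2.1.1.depth p‖) fun _ => norm_nonneg _).2
    ⟨fun k => Summable.of_finite, ?_⟩
  have h1 (k : ℕ) : (∑' L : {L : PLattice p V // L.1.depth p = k},
      ‖u ^ padicValNat p L.1.1.index * v ^ L.1.1.depth p‖) =
      ∑ d ∈ Finset.range (n + 1), ‖v‖ ^ k * levelSum hV ‖u‖ k d := by
    rw [← Finset.mul_sum, ← sum_level_eq,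
      tsum_depthFiber hV (fun L => ‖u ^ padicValNat p L.index * v ^ L.depth p‖), Finset.mul_sum]
    refine Finset.sum_congr rfl fun L hL => ?_
    rw [((mem_level hV).1 hL).2, norm_mul, norm_pow, norm_pow, mul_comm]
  refine Summable.congr (summable_sum fun d hd => summable_levelSum_norm hV h
    (Nat.lt_succ_iff.1 (Finset.mem_range.1 hd))) fun k => ?_
  exact (h1 k).symm

/-- The core computation: the sums G d over lattices of residual dimension d solve a triangular
system whose solution is a sum over chains below n. -/
theorem tsum_lattice (hn : 0 < n)
    (h : ∀ d < n, ‖(p : ℂ) ^ (d * (n - d)) * (u ^ (n - d) * v)‖ < 1) :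
    ∑' L : PLattice p V, u ^ padicValNat p L.1.index * v ^ L.1.depth p =
      1 / (1 - (p : ℂ) ^ (0 * (n - 0)) * (u ^ (n - 0) * v)) *
        ∑ I ∈ (Finset.Icc 1 (n - 1)).powerset, gaussMultinomial (p : ℂ)⁻¹ n I *
          ∏ d ∈ I, (p : ℂ) ^ (d * (n - d)) * (u ^ (n - d) * v) /
            (1 - (p : ℂ) ^ (d * (n - d)) * (u ^ (n - d) * v)) := by
  set x : ℕ → ℂ := fun d => (p : ℂ) ^ (d * (n - d)) * (u ^ (n - d) * v) with hx
  have hx1 (d : ℕ) (hd : d < n) : 1 - x d ≠ 0 := by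
    intro h0
    have := h d hd
    change ‖x d‖ < 1 at this
    rw [← sub_eq_zero.1 h0, norm_one] at this
    exact lt_irrefl _ this
  have hsum : ∀ d ∈ Finset.range (n + 1), Summable fun k => v ^ k * levelSum hV u k d := by
    intro d hd
    refine Summable.of_norm_bounded (summable_levelSum_norm hV h
      (Nat.lt_succ_iff.1 (Finset.mem_range.1 hd))) fun k => ?_
    rw [norm_mul, norm_pow]
    exact mul_le_mul_of_nonneg_left (norm_levelSum_le hV u k d) (by positivity)
  set G : ℕ → ℂ := fun d => ∑' k, v ^ k * levelSum hV u k d with hG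
  have htot : ∑' L : PLattice p V, u ^ padicValNat p L.1.index * v ^ L.1.depth p =
      ∑ d ∈ Finset.range (n + 1), G d := by
    have hs := (summable_norm_lattice hV h).of_norm
    have hs' := (Equiv.summable_iff
      (Equiv.sigmaFiberEquiv fun L : PLattice p V => L.1.depth p)).2 hs
    rw [← (Equiv.sigmaFiberEquiv fun L : PLattice p V => L.1.depth p).tsum_eq,
      ← Summable.tsum_finsetSum hsum]
    refine hs'.tsum_sigma.trans (tsum_congr fun k => ?_)
    rw [← Finset.mul_sum, ← sum_level_eq]
    change (∑' L : {L : PLattice p V // L.1.depth p = k},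
      u ^ padicValNat p L.1.1.index * v ^ L.1.1.depth p) = _
    rw [tsum_depthFiber hV (fun L => u ^ padicValNat p L.index * v ^ L.depth p), Finset.mul_sum]
    refine Finset.sum_congr rfl fun L hL => ?_
    rw [((mem_level hV).1 hL).2, mul_comm]
  have hGn : G n = 1 := by
    rw [hG]
    dsimp only
    rw [tsum_eq_single 0, levelSum_zero]
    · simp
    · rintro (_ | k) hk
      · exact absurd rfl hk
      · rw [levelSum_succ_self, mul_zero]
  have hGrec (d : ℕ) (hd : d < n) : G d = (u ^ (n - d) * v) *
      ∑ w ∈ Finset.range (n + 1), (upFiberCard p n w d : ℂ) * G w := by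
    rw [hG]
    dsimp only
    -- Depth 0 contributes nothing: the only lattice there is V, of residual dimension n ≠ d.
    rw [(hsum d (Finset.mem_range.2 (by omega))).tsum_eq_zero_add, levelSum_zero, if_neg hd.ne,
      mul_zero, zero_add]
    simp only [← tsum_mul_left]
    rw [← Summable.tsum_finsetSum fun w hw => (hsum w hw).mul_left _, ← tsum_mul_left]
    refine tsum_congr fun k => ?_
    rw [levelSum_succ hV _ hd, Finset.mul_sum, Finset.mul_sum, Finset.mul_sum]
    exact Finset.sum_congr rfl fun w _ => by ring
  have hGz (d : ℕ) (hd : d < n) : G d = x d / (1 - x d) *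
      ∑ w ∈ Finset.Ioc d n, G w * gaussBinom (p : ℂ)⁻¹ w d := by
    have h1 : G d = x d * G d + x d * ∑ w ∈ Finset.Ioc d n, G w * gaussBinom (p : ℂ)⁻¹ w d := by
      conv_lhs => rw [hGrec d hd]
      rw [← Finset.sum_subset (s₁ := Finset.Icc d n)]
      · rw [← Finset.sum_Ioc_add_eq_sum_Icc hd.le, mul_add, add_comm, upFiberCard_self hp.out]
        congr 1
        · rw [hx]
          push_cast
          ring
        · rw [Finset.mul_sum, Finset.mul_sum]
          refine Finset.sum_congr rfl fun w hw => ?_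
          rw [Finset.mem_Ioc] at hw
          -- The closed form of the fibre count needs a lattice of residual dimension w; if none
          -- exists, G w = 0 and the term is harmless.
          by_cases hGw : G w = 0
          · rw [hGw]
            ring
          · have hex : ∃ N : AddSubgroup V, N.IsPLattice p ∧ N.resDim p = w := by
              by_contra hno
              push Not at hno
              apply hGw
              rw [hG]
              dsimp only
              convert tsum_zero with k
              rw [levelSum, Finset.filter_eq_empty_iff.2, Finset.sum_empty, mul_zero]
              intro L hL
              exact hno L ((mem_level hV).1 hL).1
            obtain ⟨N, hN, hNw⟩ := hex
            rw [cast_upFiberCard hp.out hw.1.le hw.2 (prod_dvd_upFiberCard hV N hN hNw d)]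
            ring
      · intro w hw
        rw [Finset.mem_Icc] at hw
        exact Finset.mem_range.2 (by omega)
      · intro w hw hw'
        rw [Finset.mem_range] at hw
        rw [Finset.mem_Icc] at hw'
        rw [upFiberCard_eq_zero (by omega), Nat.cast_zero, zero_mul]
    rw [div_mul_eq_mul_div, eq_div_iff (hx1 d hd)]
    linear_combination h1
  rw [htot, sum_eq_multinomialSum hn (p : ℂ)⁻¹ (fun d => x d / (1 - x d)) G hGn hGz]
  change _ = 1 / (1 - x 0) * _
  congr 1
  have := hx1 0 hn
  field_simp
  ring

end LatticeSum

/-! ### Lattices in finite free ℤ_p-modules and their topology -/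

section Padic

open AddSubgroup

variable {p : ℕ} [hp : Fact p.Prime]

theorem multiples_padicInt : multiples ℤ_[p] p = (PadicInt.toZMod (p := p)).toAddMonoidHom.ker := by
  ext x
  rw [AddMonoidHom.mem_ker]
  change _ ↔ x ∈ RingHom.ker (PadicInt.toZMod (p := p))
  rw [PadicInt.ker_toZMod, PadicInt.maximalIdeal_eq_span_p, Ideal.mem_span_singleton]
  constructor
  · rintro ⟨y, rfl⟩
    exact ⟨y, nsmul_eq_mul p y⟩
  · rintro ⟨y, rfl⟩
    exact ⟨y, nsmul_eq_mul p y⟩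

theorem index_multiples_padicInt : (multiples ℤ_[p] p).index = p := by
  rw [multiples_padicInt, index_ker, AddMonoidHom.range_eq_top.2, Nat.card_congr topEquiv.toEquiv,
    Nat.card_zmod]
  exact ZMod.ringHom_surjective (PadicInt.toZMod (p := p))

theorem isPFreeOfRank_fun_padicInt (r : ℕ) : IsPFreeOfRank p r (Fin r → ℤ_[p]) where
  eq_zero_of_nsmul x hx := funext fun i => by
    have h := congrFun hx i
    rw [Pi.smul_apply, nsmul_eq_mul, Pi.zero_apply, mul_eq_zero] at h
    exact h.resolve_left (Nat.cast_ne_zero.2 hp.out.ne_zero)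
  index_multiples := by
    have : multiples (Fin r → ℤ_[p]) p = AddSubgroup.pi Set.univ fun _ => multiples ℤ_[p] p := by
      ext x
      rw [AddSubgroup.mem_pi]
      constructor
      · rintro ⟨y, rfl⟩ i -
        exact ⟨y i, rfl⟩
      · intro h
        choose y hy using fun i => h i trivial
        exact ⟨y, funext hy⟩
    rw [this, index_pi]
    simp [index_multiples_padicInt]

omit hp in
theorem IsPFreeOfRank.of_addEquiv {n : ℕ} {V W : Type*} [AddCommGroup V] [AddCommGroup W]
    (hW : IsPFreeOfRank p n W) (e : V ≃+ W) : IsPFreeOfRank p n V where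
  eq_zero_of_nsmul x hx := by
    have := hW.eq_zero_of_nsmul (e x) (by rw [← map_nsmul, hx, map_zero])
    exact e.map_eq_zero_iff.1 this
  index_multiples := by
    rw [← hW.index_multiples, ← index_comap_of_surjective (f := (e : V →+ W)) _ e.surjective]
    congr 1
    ext x
    constructor
    · rintro ⟨y, rfl⟩
      exact ⟨e y, (map_nsmul e p y).symm⟩
    · rintro ⟨y, hy⟩
      refine ⟨e.symm y, e.injective ?_⟩
      rw [← AddEquiv.coe_toAddMonoidHom e]
      refine Eq.trans ?_ hy
      simp

section Module

variable {V : Type*} [AddCommGroup V] [Module ℤ_[p] V] [Module.Finite ℤ_[p] V]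
  [Module.Free ℤ_[p] V]

theorem isPFreeOfRank_finrank : IsPFreeOfRank p (Module.finrank ℤ_[p] V) V :=
  (isPFreeOfRank_fun_padicInt _).of_addEquiv (Module.finBasis ℤ_[p] V).equivFun.toAddEquiv

theorem eq_zero_of_forall_mem_multiples_pow {x : V} (h : ∀ k, x ∈ multiples V (p ^ k)) :
    x = 0 := by
  let e := (Module.finBasis ℤ_[p] V).equivFun
  refine e.map_eq_zero_iff.1 (funext fun i => ?_)
  by_contra hne
  have hp' : ¬ IsUnit (p : ℤ_[p]) := (PadicInt.prime_p (p := p)).not_isUnit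
  have hfin := FiniteMultiplicity.of_not_isUnit hp' hne
  obtain ⟨k, hk⟩ := hfin
  obtain ⟨y, rfl⟩ := h (k + 1)
  refine hk ⟨e y i, ?_⟩
  simp

-- Modulo p^k a p-adic integer is a natural number, and p^k V already lies in L.
omit [Module.Finite ℤ_[p] V] [Module.Free ℤ_[p] V] in
theorem padicInt_smul_mem {L : AddSubgroup V} (hL : L.IsPLattice p) (z : ℤ_[p]) {x : V}
    (hx : x ∈ L) : z • x ∈ L := by
  obtain ⟨k, hk⟩ := hL
  have h := PadicInt.appr_spec k z
  rw [Ideal.mem_span_singleton] at h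
  obtain ⟨y, hy⟩ := h
  have hz : z • x = z.appr k • x + p ^ k • (y • x) := by
    conv_lhs => rw [sub_eq_iff_eq_add.1 hy, add_smul, add_comm, mul_smul, ← Nat.cast_pow,
      Nat.cast_smul_eq_nsmul, Nat.cast_smul_eq_nsmul]
  rw [hz]
  exact L.add_mem (L.nsmul_mem hx _) (hk _)

/-- A `p`-lattice in a `ℤ_p`-module is a `ℤ_p`-submodule. -/
def submoduleOfIsPLattice {L : AddSubgroup V} (hL : L.IsPLattice p) : Submodule ℤ_[p] V :=
  { L with smul_mem' := fun z _ hx => padicInt_smul_mem hL z hx }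

/-- Additive maps into a group of exponent dividing `p ^ k` are determined freely by the values on
a `ℤ_p`-basis. -/
theorem card_addMonoidHom_of_pow_nsmul_eq_zero {A : Type*} [AddCommGroup A] (k : ℕ)
    (hA : ∀ a : A, p ^ k • a = 0) :
    Nat.card (V →+ A) = Nat.card A ^ Module.finrank ℤ_[p] V := by
  let : Module (ZMod (p ^ k)) A := AddCommGroup.zmodModule hA
  let : Module ℤ_[p] A := Module.compHom A (PadicInt.toZModPow k : ℤ_[p] →+* ZMod (p ^ k))
  -- Additive maps are automatically ℤ_p-linear, since p^k kills A and z is a natural number modulo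
  -- p^k.
  have hlin (f : V →+ A) (z : ℤ_[p]) (x : V) : f (z • x) = z • f x := by
    have h := PadicInt.appr_spec k z
    rw [Ideal.mem_span_singleton] at h
    obtain ⟨y, hy⟩ := h
    rw [sub_eq_iff_eq_add.1 hy, add_smul, add_smul, map_add, mul_smul, mul_smul, ← Nat.cast_pow,
      Nat.cast_smul_eq_nsmul, Nat.cast_smul_eq_nsmul, Nat.cast_smul_eq_nsmul,
      Nat.cast_smul_eq_nsmul, map_nsmul, map_nsmul, hA, hA]
  let e : (V →+ A) ≃ (V →ₗ[ℤ_[p]] A) :=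
    { toFun := fun f => { f with map_smul' := hlin f }
      invFun := fun f => f.toAddMonoidHom
      left_inv := fun _ => rfl
      right_inv := fun _ => rfl }
  rw [Nat.card_congr (e.trans ((Module.finBasis ℤ_[p] V).constr ℤ_[p]).symm.toEquiv),
    Nat.card_fun, Nat.card_fin]

/-- M is itself free over ℤ_p, and its rank is that of V because |M/pM| = |V/pV|. -/
theorem card_addMonoidHom_isPLattice {M : AddSubgroup V} (hM : M.IsPLattice p) {A : Type*}
    [AddCommGroup A] (k : ℕ) (hA : ∀ a : A, p ^ k • a = 0) :
    Nat.card (M →+ A) = Nat.card A ^ Module.finrank ℤ_[p] V := by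
  have h1 := card_addMonoidHom_of_pow_nsmul_eq_zero (V := submoduleOfIsPLattice hM) k hA
  have h2 : IsPFreeOfRank p (Module.finrank ℤ_[p] V) (submoduleOfIsPLattice hM) :=
    isPFreeOfRank_of_isPLattice isPFreeOfRank_finrank hM
  have h3 : IsPFreeOfRank p (Module.finrank ℤ_[p] (submoduleOfIsPLattice hM))
    (submoduleOfIsPLattice hM) := isPFreeOfRank_finrank
  have h4 := h3.index_multiples
  rw [h2.index_multiples] at h4
  rw [Nat.pow_right_injective hp.out.two_le h4]
  exact h1

end Module

section Topology

variable {n : ℕ} {V : Type*} [AddCommGroup V] [TopologicalSpace V] [IsTopologicalAddGroup V]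
  [CompactSpace V] [T2Space V]

omit [T2Space V] in
theorem isCompact_multiples (m : ℕ) : IsCompact (multiples V m : Set V) := by
  have : (multiples V m : Set V) = Set.range fun x : V => m • x := rfl
  rw [this]
  exact isCompact_range (continuous_nsmul m)

/-- p^k V is compact, hence closed, and a closed subgroup of finite index is open. -/
theorem isOpen_multiples_pow (hV : IsPFreeOfRank p n V) (k : ℕ) :
    IsOpen (multiples V (p ^ k) : Set V) := by
  have : (multiples V (p ^ k)).FiniteIndex := ⟨by
    rw [hV.index_multiples_pow]
    exact pow_ne_zero _ hp.out.ne_zero⟩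
  exact isOpen_of_isClosed_of_finiteIndex _ (isCompact_multiples _).isClosed

-- The compact sets p^k V decrease to {0}, so one of them lies in the given neighbourhood. With
-- `isOpen_multiples_pow` this shows that any compact Hausdorff group topology here is the p-adic
-- one.
omit hp in
theorem exists_multiples_pow_subset (hsep : ∀ x : V, (∀ k, x ∈ multiples V (p ^ k)) → x = 0)
    {U : Set V} (hU : U ∈ nhds (0 : V)) : ∃ k, ∀ x : V, p ^ k • x ∈ U := by
  have hdir : Directed (· ⊇ ·) fun k => (multiples V (p ^ k) : Set V) := by
    refine (antitone_nat_of_succ_le (f := fun k => (multiples V (p ^ k) : Set V))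
      fun k => ?_).directed_ge
    rintro _ ⟨y, rfl⟩
    refine ⟨p • y, ?_⟩
    simp [pow_succ, mul_smul]
  obtain ⟨k, hk⟩ := exists_subset_nhds_of_isCompact hdir (fun k => isCompact_multiples _)
    (U := U) fun x hx => by
      rw [hsep x fun k => Set.mem_iInter.1 hx k]
      exact hU
  exact ⟨k, fun x => hk ⟨x, rfl⟩⟩

theorem isOpen_iff_isPLattice (hV : IsPFreeOfRank p n V)
    (hsep : ∀ x : V, (∀ k, x ∈ multiples V (p ^ k)) → x = 0) (L : AddSubgroup V) :
    IsOpen (L : Set V) ↔ L.IsPLattice p := by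
  constructor
  · intro h
    exact exists_multiples_pow_subset hsep (h.mem_nhds L.zero_mem)
  · rintro ⟨k, hk⟩
    refine isOpen_mono (H₁ := multiples V (p ^ k)) ?_ (isOpen_multiples_pow hV k)
    rintro _ ⟨x, rfl⟩
    exact hk x

end Topology

end Padic

/-! ### Normal subgroups of the Heisenberg group as glued pairs -/

section Heisenberg

open AddSubgroup

variable {R : Type*} [CommRing R]

/-- The element of the Heisenberg group with entries `a`, `b` above the diagonal and `c` in the
corner. -/
def heisMk (a b c : R) : heisenbergGroup R :=
  ⟨⟨!![1, a, c; 0, 1, b; 0, 0, 1], !![1, -a, a * b - c; 0, 1, -b; 0, 0, 1], by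
    ext i j; fin_cases i <;> fin_cases j <;> simp [Matrix.mul_apply, Fin.sum_univ_three]
    ring, by
    ext i j; fin_cases i <;> fin_cases j <;> simp [Matrix.mul_apply, Fin.sum_univ_three]
    ring⟩,
    a, b, c, rfl⟩

/-- The two entries next to the diagonal. -/
def heisBase (g : heisenbergGroup R) : R × R := (g.1.1 0 1, g.1.1 1 2)

/-- The corner entry. -/
def heisCorner (g : heisenbergGroup R) : R := g.1.1 0 2

@[simp] theorem heisBase_mk (a b c : R) : heisBase (heisMk a b c) = (a, b) := rfl

@[simp] theorem heisCorner_mk (a b c : R) : heisCorner (heisMk a b c) = c := rfl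

theorem heisMk_eta (g : heisenbergGroup R) :
    heisMk (heisBase g).1 (heisBase g).2 (heisCorner g) = g := by
  obtain ⟨g, a, b, c, h⟩ := g
  refine Subtype.ext (Units.ext ?_)
  simp [heisMk, heisBase, heisCorner, h]

theorem heisMk_mul (a b c a' b' c' : R) :
    heisMk a b c * heisMk a' b' c' = heisMk (a + a') (b + b') (c + c' + a * b') := by
  refine Subtype.ext (Units.ext ?_)
  change !![1, a, c; 0, 1, b; 0, 0, 1] * !![1, a', c'; 0, 1, b'; 0, 0, 1] =
    !![1, a + a', c + c' + a * b'; 0, 1, b + b'; 0, 0, 1]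
  ext i j
  fin_cases i <;> fin_cases j <;> simp [Matrix.mul_apply, Fin.sum_univ_three] <;> ring

theorem heisMk_zero : heisMk (0 : R) 0 0 = 1 := by
  refine Subtype.ext (Units.ext ?_)
  change !![1, 0, 0; 0, 1, 0; 0, 0, 1] = (1 : Matrix (Fin 3) (Fin 3) R)
  ext i j
  fin_cases i <;> fin_cases j <;> simp

theorem heisMk_inv (a b c : R) : (heisMk a b c)⁻¹ = heisMk (-a) (-b) (a * b - c) := by
  rw [inv_eq_iff_mul_eq_one, heisMk_mul, ← heisMk_zero]
  congr 1 <;> ring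

theorem heisBase_mul (g h : heisenbergGroup R) : heisBase (g * h) = heisBase g + heisBase h := by
  rw [← heisMk_eta g, ← heisMk_eta h, heisMk_mul]
  rfl

theorem heisCorner_mul (g h : heisenbergGroup R) :
    heisCorner (g * h) = heisCorner g + heisCorner h + (heisBase g).1 * (heisBase h).2 := by
  conv_lhs => rw [← heisMk_eta g, ← heisMk_eta h, heisMk_mul]
  rfl

theorem heisBase_inv (g : heisenbergGroup R) : heisBase g⁻¹ = -heisBase g := by
  rw [← heisMk_eta g, heisMk_inv]
  rfl

theorem heisCorner_inv (g : heisenbergGroup R) :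
    heisCorner g⁻¹ = (heisBase g).1 * (heisBase g).2 - heisCorner g := by
  conv_lhs => rw [← heisMk_eta g, heisMk_inv]
  rfl

/-- The abelianization of the Heisenberg group. -/
def heisProj : heisenbergGroup R →* Multiplicative (R × R) where
  toFun g := Multiplicative.ofAdd (heisBase g)
  map_one' := rfl
  map_mul' g h := congrArg Multiplicative.ofAdd (heisBase_mul g h)

/-- The center of the Heisenberg group. -/
def heisCenter : Multiplicative R →* heisenbergGroup R where
  toFun c := heisMk 0 0 c.toAdd
  map_one' := heisMk_zero
  map_mul' c d := by
    rw [heisMk_mul]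
    simp

theorem heisProj_surjective : Function.Surjective (heisProj : heisenbergGroup R →* _) :=
  fun m => ⟨heisMk m.toAdd.1 m.toAdd.2 0, rfl⟩

theorem ker_heisProj : (heisProj : heisenbergGroup R →* _).ker = heisCenter.range := by
  ext g
  rw [MonoidHom.mem_ker]
  constructor
  · intro h
    have h' : heisBase g = 0 := h
    refine ⟨Multiplicative.ofAdd (heisCorner g), ?_⟩
    rw [← heisMk_eta g, h']
    rfl
  · rintro ⟨c, rfl⟩
    rfl

/-- The intersection of a subgroup with the center. -/
def centerPart (N : Subgroup (heisenbergGroup R)) : AddSubgroup R :=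
  Subgroup.toAddSubgroup' (N.comap heisCenter)

/-- The image of a subgroup in the abelianization. -/
def basePart (N : Subgroup (heisenbergGroup R)) : AddSubgroup (R × R) :=
  Subgroup.toAddSubgroup' (N.map heisProj)

theorem mem_centerPart {N : Subgroup (heisenbergGroup R)} {c : R} :
    c ∈ centerPart N ↔ heisMk 0 0 c ∈ N := Iff.rfl

theorem mem_basePart {N : Subgroup (heisenbergGroup R)} {m : R × R} :
    m ∈ basePart N ↔ ∃ g ∈ N, heisBase g = m := Iff.rfl

/-- The index is multiplicative along the extension of R × R by the center. -/
theorem index_eq_basePart_mul_centerPart (N : Subgroup (heisenbergGroup R)) [N.Normal] :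
    N.index = (basePart N).index * (centerPart N).index := by
  have h1 : (basePart N).index = (N.map heisProj).index :=
    (AddSubgroup.index_toSubgroup (basePart N)).symm
  have h2 : (centerPart N).index = (N.comap heisCenter).index :=
    (AddSubgroup.index_toSubgroup (centerPart N)).symm
  rw [h1, h2, Subgroup.index_map, MonoidHom.range_eq_top.2 heisProj_surjective, Subgroup.index_top,
    mul_one, Subgroup.index_comap, ← ker_heisProj, ← Subgroup.relIndex_sup_right, sup_comm,
    mul_comm, Subgroup.relIndex_mul_index le_sup_right]

/-- All multiples of the entries of elements of `M` lie in `L`. -/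
def HeisCompat (L : AddSubgroup R) (M : AddSubgroup (R × R)) : Prop :=
  ∀ m ∈ M, ∀ r : R, m.1 * r ∈ L ∧ m.2 * r ∈ L

/-- The normal subgroup with given center part, base part and gluing homomorphism. -/
def heisSub {L : AddSubgroup R} {M : AddSubgroup (R × R)} (h : HeisCompat L M) (f : M →+ R ⧸ L) :
    Subgroup (heisenbergGroup R) where
  carrier := {g | ∃ hg : heisBase g ∈ M, f ⟨heisBase g, hg⟩ = heisCorner g}
  one_mem' := ⟨M.zero_mem, f.map_zero⟩
  mul_mem' := by
    rintro g k ⟨hg, hg'⟩ ⟨hk, hk'⟩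
    have hmem : heisBase (g * k) ∈ M := heisBase_mul g k ▸ M.add_mem hg hk
    refine ⟨hmem, ?_⟩
    have : (⟨heisBase (g * k), hmem⟩ : M) = ⟨heisBase g, hg⟩ + ⟨heisBase k, hk⟩ :=
      Subtype.ext (heisBase_mul g k)
    -- The cocycle term a·b' of the product lies in L, so corners add modulo L.
    rw [this, map_add, hg', hk', heisCorner_mul, QuotientAddGroup.mk_add, QuotientAddGroup.mk_add,
      (QuotientAddGroup.eq_zero_iff _).2 (h _ hg _).1, add_zero]
  inv_mem' := by
    rintro g ⟨hg, hg'⟩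
    have hmem : heisBase g⁻¹ ∈ M := heisBase_inv g ▸ M.neg_mem hg
    refine ⟨hmem, ?_⟩
    have : (⟨heisBase g⁻¹, hmem⟩ : M) = -⟨heisBase g, hg⟩ := Subtype.ext (heisBase_inv g)
    rw [this, map_neg, hg', heisCorner_inv, QuotientAddGroup.mk_sub,
      (QuotientAddGroup.eq_zero_iff _).2 (h _ hg _).1, zero_sub]

section HeisSub

variable {L : AddSubgroup R} {M : AddSubgroup (R × R)} (h : HeisCompat L M) (f : M →+ R ⧸ L)

theorem mem_heisSub {g : heisenbergGroup R} :
    g ∈ heisSub h f ↔ ∃ hg : heisBase g ∈ M, f ⟨heisBase g, hg⟩ = heisCorner g := Iff.rfl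

theorem normal_heisSub : (heisSub h f).Normal where
  conj_mem := by
    rintro g ⟨hg, hg'⟩ k
    have hbase : heisBase (k * g * k⁻¹) = heisBase g := by
      rw [heisBase_mul, heisBase_mul, heisBase_inv]
      abel
    refine ⟨hbase ▸ hg, ?_⟩
    have : (⟨heisBase (k * g * k⁻¹), hbase ▸ hg⟩ : M) = ⟨heisBase g, hg⟩ := Subtype.ext hbase
    rw [this, hg', QuotientAddGroup.eq]
    -- Conjugation changes the corner by a commutator, which lies in L by compatibility.
    have hcorner : -heisCorner g + heisCorner (k * g * k⁻¹) =
        (heisBase g).2 * (heisBase k).1 - (heisBase g).1 * (heisBase k).2 := by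
      rw [heisCorner_mul, heisCorner_mul, heisCorner_inv, heisBase_mul, heisBase_inv]
      simp only [Prod.fst_add, Prod.snd_neg]
      ring
    rw [hcorner]
    exact L.sub_mem (h _ hg _).2 (h _ hg _).1

theorem centerPart_heisSub : centerPart (heisSub h f) = L := by
  ext c
  rw [mem_centerPart, mem_heisSub]
  have h0 : (⟨heisBase (heisMk 0 0 c), M.zero_mem⟩ : M) = 0 := rfl
  constructor
  · rintro ⟨_, hc⟩
    rw [h0, map_zero] at hc
    exact (QuotientAddGroup.eq_zero_iff _).1 hc.symm
  · intro hc
    refine ⟨M.zero_mem, ?_⟩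
    rw [h0, map_zero]
    exact ((QuotientAddGroup.eq_zero_iff _).2 hc).symm

theorem basePart_heisSub : basePart (heisSub h f) = M := by
  ext m
  rw [mem_basePart]
  constructor
  · rintro ⟨g, ⟨hg, -⟩, rfl⟩
    exact hg
  · intro hm
    obtain ⟨c, hc⟩ := QuotientAddGroup.mk_surjective (f ⟨m, hm⟩)
    exact ⟨heisMk m.1 m.2 c, ⟨hm, hc.symm⟩, rfl⟩

end HeisSub

variable {N : Subgroup (heisenbergGroup R)}

/-- Commutators of g ∈ N with arbitrary elements are central and in N; the elements with base (0, r)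
and (r, 0) isolate the two coordinates of g. -/
theorem heisCompat_of_normal (hN : N.Normal) : HeisCompat (centerPart N) (basePart N) := by
  intro m hm r
  obtain ⟨g, hg, rfl⟩ := mem_basePart.1 hm
  have key (k : heisenbergGroup R) :
      (heisBase k).1 * (heisBase g).2 - (heisBase g).1 * (heisBase k).2 ∈ centerPart N := by
    have hmem := N.mul_mem (hN.conj_mem g hg k) (N.inv_mem hg)
    rw [mem_centerPart]
    convert hmem using 1
    rw [← heisMk_eta (k * g * k⁻¹ * g⁻¹)]
    simp only [heisBase_mul, heisBase_inv, heisCorner_mul, heisCorner_inv, Prod.fst_add,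
      Prod.snd_neg, Prod.fst_neg, Prod.snd_add]
    congr 1 <;> ring
  constructor
  · have := (centerPart N).neg_mem (key (heisMk 0 r 0))
    simpa using this
  · have := key (heisMk r 0 0)
    simpa [mul_comm] using this

/-- If the bases agree, g k⁻¹ is central. This makes the choice of representatives in `gluing`
immaterial. -/
theorem heisCorner_sub_mem {g k : heisenbergGroup R} (hg : g ∈ N) (hk : k ∈ N)
    (h : heisBase g = heisBase k) : heisCorner g - heisCorner k ∈ centerPart N := by
  have hmem := N.mul_mem hg (N.inv_mem hk)
  rw [mem_centerPart]
  convert hmem using 1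
  rw [← heisMk_eta (g * k⁻¹)]
  simp only [heisBase_mul, heisBase_inv, heisCorner_mul, heisCorner_inv, h, Prod.fst_add,
    Prod.snd_neg, Prod.fst_neg, Prod.snd_add]
  congr 1 <;> ring

/-- The homomorphism that records the corner entries of a normal subgroup modulo its center
part. -/
noncomputable def gluing (hN : N.Normal) : basePart N →+ R ⧸ centerPart N :=
  AddMonoidHom.mk' (fun m => ((heisCorner (mem_basePart.1 m.2).choose : R) : R ⧸ centerPart N))
    fun m m' => by
      have hm := (mem_basePart.1 m.2).choose_spec
      have hm' := (mem_basePart.1 m'.2).choose_spec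
      have hs := (mem_basePart.1 (m + m').2).choose_spec
      have h1 := heisCorner_sub_mem hs.1 (N.mul_mem hm.1 hm'.1) (by
        rw [hs.2, heisBase_mul, hm.2, hm'.2]
        rfl)
      have h2 := (QuotientAddGroup.eq_zero_iff _).2 h1
      rw [QuotientAddGroup.mk_sub, sub_eq_zero] at h2
      have hL : (heisBase (mem_basePart.1 m.2).choose).1 *
          (heisBase (mem_basePart.1 m'.2).choose).2 ∈ centerPart N :=
        (heisCompat_of_normal hN _ ⟨_, hm.1, rfl⟩ _).1
      rw [h2, heisCorner_mul, QuotientAddGroup.mk_add, QuotientAddGroup.mk_add,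
        (QuotientAddGroup.eq_zero_iff _).2 hL, add_zero]

theorem heisSub_gluing (hN : N.Normal) :
    heisSub (heisCompat_of_normal hN) (gluing hN) = N := by
  ext g
  rw [mem_heisSub]
  constructor
  · rintro ⟨hg, hc⟩
    have hs := (mem_basePart.1 hg).choose_spec
    change ((heisCorner (mem_basePart.1 hg).choose : R) : R ⧸ centerPart N) = _ at hc
    rw [QuotientAddGroup.eq] at hc
    convert N.mul_mem hs.1 (mem_centerPart.1 hc) using 1
    rw [← heisMk_eta (_ * _), heisBase_mul, hs.2, heisCorner_mul]
    conv_lhs => rw [← heisMk_eta g]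
    congr 1 <;> simp
  · intro hg
    have hb : heisBase g ∈ basePart N := ⟨g, hg, rfl⟩
    refine ⟨hb, ?_⟩
    have hs := (mem_basePart.1 hb).choose_spec
    have h1 := (QuotientAddGroup.eq_zero_iff _).2 (heisCorner_sub_mem hs.1 hg hs.2)
    rw [QuotientAddGroup.mk_sub, sub_eq_zero] at h1
    exact h1

end Heisenberg

/-! ### Open normal subgroups and compatible lattices -/

section HeisenbergTopology

open AddSubgroup

variable {R : Type*} [CommRing R]

section Continuity

variable [TopologicalSpace R] [IsTopologicalRing R]

omit [IsTopologicalRing R] in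
theorem continuous_heisBase : Continuous (heisBase : heisenbergGroup R → R × R) := by
  have h : Continuous fun g : heisenbergGroup R => (g.1.1 : Matrix (Fin 3) (Fin 3) R) :=
    Units.continuous_val.comp continuous_subtype_val
  exact (h.matrix_elem 0 1).prodMk (h.matrix_elem 1 2)

omit [IsTopologicalRing R] in
theorem continuous_heisCorner : Continuous (heisCorner : heisenbergGroup R → R) := by
  have h : Continuous fun g : heisenbergGroup R => (g.1.1 : Matrix (Fin 3) (Fin 3) R) :=
    Units.continuous_val.comp continuous_subtype_val
  exact h.matrix_elem 0 2

theorem Continuous.heisMk {X : Type*} [TopologicalSpace X] {a b c : X → R} (ha : Continuous a)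
    (hb : Continuous b) (hc : Continuous c) : Continuous fun x => heisMk (a x) (b x) (c x) := by
  refine Continuous.subtype_mk (Units.continuous_iff.2 ⟨?_, ?_⟩) _
  · refine continuous_matrix fun i j => ?_
    fin_cases i <;> fin_cases j <;> simp <;> fun_prop
  · refine continuous_matrix fun i j => ?_
    fin_cases i <;> fin_cases j <;> simp <;> fun_prop

end Continuity

variable {p n : ℕ}

/-- Normal subgroups whose center part and base part are `p`-lattices. -/
def IsHeisLattice (p : ℕ) (N : Subgroup (heisenbergGroup R)) : Prop :=
  N.Normal ∧ (centerPart N).IsPLattice p ∧ (basePart N).IsPLattice p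

theorem pow_nsmul_quotient_eq_zero {L : AddSubgroup R} {k : ℕ} (hk : ∀ x : R, p ^ k • x ∈ L)
    (a : R ⧸ L) : p ^ k • a = 0 := by
  obtain ⟨x, rfl⟩ := QuotientAddGroup.mk_surjective a
  rw [← QuotientAddGroup.mk_nsmul, QuotientAddGroup.eq_zero_iff]
  exact hk x

/-- The factor p^j brings the base into M, and the further factor p^k kills both the value of f and
the corner in R/L. -/
theorem mem_heisSub_of_nsmul {L : AddSubgroup R} {M : AddSubgroup (R × R)} (h : HeisCompat L M)
    (f : M →+ R ⧸ L) {j k : ℕ} (hj : ∀ x : R × R, p ^ j • x ∈ M) (hk : ∀ x : R, p ^ k • x ∈ L)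
    {g : heisenbergGroup R} (hb : heisBase g ∈ multiples (R × R) (p ^ (j + k)))
    (hc : heisCorner g ∈ multiples R (p ^ (j + k))) : g ∈ heisSub h f := by
  obtain ⟨m, hm⟩ := hb
  obtain ⟨c, hc⟩ := hc
  have hm' : heisBase g = p ^ k • (p ^ j • m) := by
    rw [← hm, ← mul_smul, ← pow_add, add_comm]
    rfl
  have hc' : heisCorner g = p ^ k • (p ^ j • c) := by
    rw [← hc, ← mul_smul, ← pow_add, add_comm]
    rfl
  have hmem : heisBase g ∈ M := hm' ▸ M.nsmul_mem (hj m) _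
  refine ⟨hmem, ?_⟩
  have : (⟨heisBase g, hmem⟩ : M) = p ^ k • ⟨p ^ j • m, hj m⟩ := Subtype.ext hm'
  rw [this, map_nsmul, pow_nsmul_quotient_eq_zero hk, hc', QuotientAddGroup.mk_nsmul,
    pow_nsmul_quotient_eq_zero hk]

theorem heisNormal_isOpen_iff [TopologicalSpace R] [IsTopologicalRing R] [CompactSpace R]
    [T2Space R] [hp : Fact p.Prime] (hR : IsPFreeOfRank p n R)
    (hsep : ∀ x : R, (∀ k, x ∈ multiples R (p ^ k)) → x = 0)
    {N : Subgroup (heisenbergGroup R)} :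
    N.Normal ∧ IsOpen (N : Set (heisenbergGroup R)) ↔ IsHeisLattice p N := by
  constructor
  · rintro ⟨hN, hopen⟩
    refine ⟨hN, ?_, ?_⟩
    · rw [← isOpen_iff_isPLattice hR hsep]
      exact hopen.preimage (continuous_const.heisMk continuous_const continuous_id)
    -- The base part contains the sums of small elements along the two axes, which suffices to make
    -- it a lattice.
    · have h1 : {a : R | heisMk a 0 0 ∈ N} ∈ nhds (0 : R) :=
        (hopen.preimage (continuous_id.heisMk continuous_const continuous_const)).mem_nhds
          (by
            change heisMk (0 : R) 0 0 ∈ N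
            rw [heisMk_zero]
            exact N.one_mem)
      have h2 : {a : R | heisMk 0 a 0 ∈ N} ∈ nhds (0 : R) :=
        (hopen.preimage (continuous_const.heisMk continuous_id continuous_const)).mem_nhds
          (by
            change heisMk (0 : R) 0 0 ∈ N
            rw [heisMk_zero]
            exact N.one_mem)
      obtain ⟨k, hk⟩ := exists_multiples_pow_subset hsep (Filter.inter_mem h1 h2)
      refine ⟨k, fun m => mem_basePart.2 ⟨heisMk (p ^ k • m.1) 0 0 * heisMk 0 (p ^ k • m.2) 0,
        N.mul_mem (hk m.1).1 (hk m.2).2, ?_⟩⟩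
      rw [heisBase_mul]
      exact Prod.ext (by simp) (by simp)
  · rintro ⟨hN, ⟨k, hk⟩, ⟨j, hj⟩⟩
    refine ⟨hN, ?_⟩
    rw [← heisSub_gluing hN]
    refine Subgroup.isOpen_of_mem_nhds _ (g := 1) ?_
    have hopen := isOpen_multiples_pow hR (j + k)
    have h1 : IsOpen {g : heisenbergGroup R | (heisBase g).1 ∈ multiples R (p ^ (j + k)) ∧
        (heisBase g).2 ∈ multiples R (p ^ (j + k)) ∧
        heisCorner g ∈ multiples R (p ^ (j + k))} :=
      (hopen.preimage (continuous_fst.comp continuous_heisBase)).inter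
        ((hopen.preimage (continuous_snd.comp continuous_heisBase)).inter
          (hopen.preimage continuous_heisCorner))
    refine Filter.mem_of_superset (h1.mem_nhds
      ⟨(multiples R (p ^ (j + k))).zero_mem, (multiples R (p ^ (j + k))).zero_mem,
        (multiples R (p ^ (j + k))).zero_mem⟩) ?_
    rintro g ⟨⟨a, ha⟩, ⟨b, hb⟩, hc⟩
    exact mem_heisSub_of_nsmul _ _ hj hk ⟨(a, b), Prod.ext ha hb⟩ hc

theorem heisSub_injective {L L' : AddSubgroup R} {M M' : AddSubgroup (R × R)}
    {h : HeisCompat L M} {h' : HeisCompat L' M'} {f : M →+ R ⧸ L} {f' : M' →+ R ⧸ L'}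
    (e : heisSub h f = heisSub h' f') : L = L' ∧ M = M' ∧ HEq f f' := by
  obtain rfl : L = L' := by rw [← centerPart_heisSub h f, e, centerPart_heisSub]
  obtain rfl : M = M' := by rw [← basePart_heisSub h f, e, basePart_heisSub]
  refine ⟨rfl, rfl, heq_of_eq ?_⟩
  ext m
  obtain ⟨c, hc⟩ := QuotientAddGroup.mk_surjective (f m)
  have hmem : heisMk m.1.1 m.1.2 c ∈ heisSub h f := ⟨m.2, hc.symm⟩
  rw [e] at hmem
  obtain ⟨h1, h2⟩ := hmem
  rw [← hc]
  exact h2.symm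

/-- Normal subgroups with lattice parts correspond to compatible pairs of lattices together with a
gluing homomorphism. -/
noncomputable def heisLatticeEquiv (p : ℕ) :
    (Σ L : PLattice p R, Σ M : {M : PLattice p (R × R) // HeisCompat L.1 M.1},
      (M.1.1 →+ R ⧸ L.1)) ≃ {N : Subgroup (heisenbergGroup R) // IsHeisLattice p N} := by
  refine Equiv.ofBijective (fun q => ⟨heisSub q.2.1.2 q.2.2, normal_heisSub _ _, ?_, ?_⟩) ⟨?_, ?_⟩
  · rw [centerPart_heisSub]
    exact q.1.2
  · rw [basePart_heisSub]
    exact q.2.1.1.2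
  · rintro ⟨⟨L, hL⟩, ⟨⟨M, hM⟩, h⟩, f⟩ ⟨⟨L', hL'⟩, ⟨⟨M', hM'⟩, h'⟩, f'⟩ e
    obtain ⟨rfl, rfl, hf⟩ := heisSub_injective (h := h) (h' := h') (f := f) (f' := f')
      (congrArg Subtype.val e)
    obtain rfl := eq_of_heq hf
    rfl
  · rintro ⟨N, hN, hL, hM⟩
    exact ⟨⟨⟨centerPart N, hL⟩, ⟨⟨basePart N, hM⟩, heisCompat_of_normal hN⟩, gluing hN⟩,
      Subtype.ext (heisSub_gluing hN)⟩

section Compat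

variable [IsDomain R] [IsDiscreteValuationRing R]

/-- A nonzero a is p^j times a unit, so aR = p^j R, and aR ⊆ L means that the depth of L is at most
j. This is where p must be a uniformizer. -/
theorem heisCompat_iff (hp : Irreducible (p : R)) {L : AddSubgroup R} (hL : L.IsPLattice p)
    (M : AddSubgroup (R × R)) :
    HeisCompat L M ↔ M ≤ multiples (R × R) (p ^ L.depth p) := by
  constructor
  · intro h m hm
    have key (a : R) (ha : ∀ r : R, a * r ∈ L) : ∃ b, p ^ L.depth p • b = a := by
      rcases eq_or_ne a 0 with rfl | ha0
      · exact ⟨0, smul_zero _⟩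
      · obtain ⟨j, u, hu⟩ := IsDiscreteValuationRing.associated_pow_irreducible ha0 hp
        have hj : L.depth p ≤ j := by
          rw [← nsmul_mem_iff_depth_le hL]
          intro x
          have := ha (u * x)
          rw [← mul_assoc, hu] at this
          rw [nsmul_eq_mul, Nat.cast_pow]
          exact this
        obtain ⟨i, rfl⟩ := Nat.exists_eq_add_of_le hj
        refine ⟨(p : R) ^ i * ↑u⁻¹, ?_⟩
        rw [nsmul_eq_mul, Nat.cast_pow, ← mul_assoc, ← pow_add, ← hu, Units.mul_inv_cancel_right]
    obtain ⟨a, ha⟩ := key m.1 fun r => (h m hm r).1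
    obtain ⟨b, hb⟩ := key m.2 fun r => (h m hm r).2
    exact ⟨(a, b), Prod.ext ha hb⟩
  · intro h m hm r
    obtain ⟨x, rfl⟩ := h hm
    constructor
    · change (p ^ L.depth p • x.1) * r ∈ L
      rw [smul_mul_assoc]
      exact pow_depth_nsmul_mem hL _
    · change (p ^ L.depth p • x.2) * r ∈ L
      rw [smul_mul_assoc]
      exact pow_depth_nsmul_mem hL _

end Compat

/-- Lattices inside `p ^ k V` correspond to lattices in `V`. -/
noncomputable def scaledLatticeEquiv {V : Type*} [AddCommGroup V] (hV : IsPFreeOfRank p n V)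
    (k : ℕ) :
    PLattice p V ≃ {M : PLattice p V // M.1 ≤ multiples V (p ^ k)} := by
  have hinj : Function.Injective (nsmulAddMonoidHom (p ^ k) : V →+ V) := by
    induction k with
    | zero => intro x y h; simpa using h
    | succ k ih =>
      intro x y h
      refine ih (hV.nsmul_injective ?_)
      simpa [pow_succ', mul_smul] using h
  exact
  { toFun := fun M => ⟨⟨M.1.map (nsmulAddMonoidHom (p ^ k)), by
        obtain ⟨j, hj⟩ := M.2
        refine ⟨k + j, fun x => ⟨p ^ j • x, hj x, ?_⟩⟩
        simp [pow_add, mul_smul]⟩, by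
      rintro _ ⟨x, -, rfl⟩
      exact ⟨x, rfl⟩⟩
    invFun := fun M => ⟨M.1.1.comap (nsmulAddMonoidHom (p ^ k)), by
        obtain ⟨j, hj⟩ := M.1.2
        exact ⟨j, fun x => by
          change p ^ k • p ^ j • x ∈ M.1.1
          rw [smul_comm]
          exact hj _⟩⟩
    left_inv := fun M => Subtype.ext (comap_map_eq_self_of_injective hinj M.1)
    right_inv := fun M => Subtype.ext (Subtype.ext (map_comap_eq_self M.2)) }

theorem index_scaledLatticeEquiv {V : Type*} [AddCommGroup V] (hV : IsPFreeOfRank p n V) (k : ℕ)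
    (M : PLattice p V) : (scaledLatticeEquiv hV k M).1.1.index = M.1.index * p ^ (n * k) :=
  hV.index_map_pow_nsmul M.1 k

end HeisenbergTopology

/-! ### Dirichlet series as sums over subgroups; convergence estimates -/

section ZetaFunction

variable {G : Type*} [Group G] [TopologicalSpace G]

/-- The open normal subgroups of a topological group. -/
abbrev OpenNormal (G : Type*) [Group G] [TopologicalSpace G] : Type _ :=
  {N : Subgroup G // N.Normal ∧ IsOpen (N : Set G)}

/-- Open normal subgroups of index `m`. -/
def openNormalFiberEquiv (m : ℕ) :
    {N : OpenNormal G // N.1.index = m} ≃ normalSubgroupsOfIndex G m where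
  toFun N := ⟨N.1.1, N.1.2.1, N.1.2.2, N.2⟩
  invFun N := ⟨⟨N.1, N.2.1, N.2.2.1⟩, N.2.2.2⟩
  left_inv _ := rfl
  right_inv _ := rfl

/-- An infinite family with constant term m^(-s) ≠ 0 is not summable. -/
theorem finite_normalSubgroupsOfIndex {s : ℂ}
    (hs : Summable fun N : OpenNormal G => ‖(N.1.index : ℂ) ^ (-s)‖) {m : ℕ} (hm : m ≠ 0) :
    (normalSubgroupsOfIndex G m).Finite := by
  by_contra hinf
  have : Infinite (normalSubgroupsOfIndex G m) := Set.infinite_coe_iff.2 hinf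
  have : Infinite {N : OpenNormal G // N.1.index = m} :=
    (openNormalFiberEquiv m).infinite_iff.2 this
  have h := hs.comp_injective
    (Subtype.val_injective (p := fun N : OpenNormal G => N.1.index = m))
  have h' : (fun N : {N : OpenNormal G // N.1.index = m} => ‖(N.1.1.index : ℂ) ^ (-s)‖) =
      fun _ => ‖(m : ℂ) ^ (-s)‖ := by
    ext N
    rw [N.2]
  have h2 : Summable fun _ : {N : OpenNormal G // N.1.index = m} => ‖(m : ℂ) ^ (-s)‖ := h' ▸ h
  rw [summable_const_iff, norm_eq_zero, Complex.cpow_eq_zero_iff] at h2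
  exact hm (Nat.cast_eq_zero.1 h2.1)

/-- Group the subgroups by index. Infinite index must be excluded: it is recorded as 0, where the
L-series term is 0. -/
theorem hasSum_normalZeta (hidx : ∀ N : OpenNormal G, N.1.index ≠ 0) {s : ℂ}
    (hs : Summable fun N : OpenNormal G => ‖(N.1.index : ℂ) ^ (-s)‖) :
    HasSum (LSeries.term (normalSubgroupCount G) s)
      (∑' N : OpenNormal G, (N.1.index : ℂ) ^ (-s)) := by
  have h := (Equiv.hasSum_iff (Equiv.sigmaFiberEquiv fun N : OpenNormal G => N.1.index)).2
    hs.of_norm.hasSum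
  refine h.sigma fun m => ?_
  rcases eq_or_ne m 0 with rfl | hm
  · have : IsEmpty {N : OpenNormal G // N.1.index = 0} := ⟨fun N => hidx N.1 N.2⟩
    rw [LSeries.term_zero]
    exact hasSum_empty
  · have hfin := finite_normalSubgroupsOfIndex hs hm
    have : Finite (normalSubgroupsOfIndex G m) := hfin
    have : Finite {N : OpenNormal G // N.1.index = m} :=
      Finite.of_equiv _ (openNormalFiberEquiv m).symm
    have := Fintype.ofFinite {N : OpenNormal G // N.1.index = m}
    have hterm : LSeries.term (normalSubgroupCount G) s m =
        ∑ N : {N : OpenNormal G // N.1.index = m}, (N.1.1.index : ℂ) ^ (-s) := by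
      rw [Finset.sum_congr rfl fun N _ => by rw [N.2], Finset.sum_const, Finset.card_univ,
        ← Nat.card_eq_fintype_card, Nat.card_congr (openNormalFiberEquiv m), Nat.card_coe_set_eq,
        LSeries.term_of_ne_zero hm, Complex.cpow_neg, nsmul_eq_mul, div_eq_mul_inv]
      rfl
    rw [hterm]
    exact hasSum_fintype _

theorem summable_sigma_const {Q : Type*} {F : Q → Type*} [∀ q, Finite (F q)] {g : Q → ℂ}
    (hg : Summable fun q => ‖(Nat.card (F q) : ℂ) * g q‖) :
    (Summable fun x : Σ q, F q => ‖g x.1‖) ∧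
      ∑' x : Σ q, F q, g x.1 = ∑' q, (Nat.card (F q) : ℂ) * g q := by
  have h : Summable fun x : Σ q, F q => ‖g x.1‖ := by
    refine (summable_sigma_of_nonneg fun _ => norm_nonneg _).2
      ⟨fun q => Summable.of_finite, hg.congr fun q => ?_⟩
    simp only [tsum_const, nsmul_eq_mul, norm_mul, Complex.norm_natCast]
  refine ⟨h, h.of_norm.tsum_sigma.trans (tsum_congr fun q => ?_)⟩
  simp only [tsum_const, nsmul_eq_mul]

variable {p : ℕ} [hp : Fact p.Prime]

theorem natCast_cpow_neg_eq {m e : ℕ} (h : m = p ^ e) (s : ℂ) :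
    (m : ℂ) ^ (-s) = ((p : ℂ) ^ (-s)) ^ padicValNat p m := by
  rw [h, padicValNat.prime_pow]
  induction e generalizing m with
  | zero => simp
  | succ e ih =>
    rw [pow_succ, Nat.cast_mul, Complex.natCast_mul_natCast_cpow, ih rfl, pow_succ]

theorem norm_padic_term_lt_one {r : ℕ} {s : ℂ} (hs : (r : ℝ) - 1 < s.re) {d : ℕ} (hd : d < r) :
    ‖(p : ℂ) ^ (d * (r - d)) * (((p : ℂ) ^ (-s)) ^ (r - d) * 1)‖ < 1 := by
  have hp1 : (1 : ℝ) < p := Nat.one_lt_cast.2 hp.out.one_lt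
  -- The term is (p^d · p^(-s))^(r-d), and d - Re s < 0.
  rw [mul_one, pow_mul, ← mul_pow, norm_pow]
  refine pow_lt_one₀ (norm_nonneg _) ?_ (by omega)
  rw [norm_mul, norm_pow, Complex.norm_natCast, Complex.norm_natCast_cpow_of_pos hp.out.pos,
    ← Real.rpow_natCast, ← Real.rpow_add (by linarith)]
  refine Real.rpow_lt_one_of_one_lt_of_neg hp1 ?_
  have : (d : ℝ) + 1 ≤ r := by exact_mod_cast hd
  simp only [Complex.neg_re]
  linarith

theorem norm_heis_term_lt_one {n : ℕ} {s : ℂ} (hs : 2 * (n : ℝ) - 1 < s.re) {d : ℕ} (hd : d < n) :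
    ‖(p : ℂ) ^ (d * (n - d)) *
      (((p : ℂ) ^ (2 * n) * (p : ℂ) ^ (-s)) ^ (n - d) * ((p : ℂ) ^ (-s)) ^ (2 * n))‖ < 1 := by
  have hp1 : (1 : ℝ) < p := Nat.one_lt_cast.2 hp.out.one_lt
  set q : ℝ := ‖(p : ℂ) ^ (-s)‖ with hq
  have hq1 : (p : ℝ) ^ (2 * n - 1) * q < 1 := by
    rw [hq, Complex.norm_natCast_cpow_of_pos hp.out.pos, ← Real.rpow_natCast,
      ← Real.rpow_add (by linarith)]
    refine Real.rpow_lt_one_of_one_lt_of_neg hp1 ?_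
    rw [Nat.cast_sub (by omega)]
    push_cast
    simp only [Complex.neg_re]
    linarith
  have hq0 : 0 ≤ q := norm_nonneg _
  -- The norm has 3n - d factors q = |p^(-s)|, each less than p^(-(2n-1)), so (2n+d)(n-d) ≤
  -- (2n-1)(3n-d) is enough.
  have hexp : d * (n - d) + 2 * n * (n - d) ≤ (2 * n - 1) * (n - d + 2 * n) := by
    obtain ⟨t, rfl⟩ : ∃ t, n = d + t + 1 := ⟨n - d - 1, by omega⟩
    have h1 : d + t + 1 - d = t + 1 := by omega
    have h2 : 2 * (d + t + 1) - 1 = 2 * d + 2 * t + 1 := by omega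
    rw [h1, h2]
    nlinarith [Nat.zero_le (d * t), Nat.zero_le (d * d), Nat.zero_le (t * t)]
  calc ‖(p : ℂ) ^ (d * (n - d)) *
      (((p : ℂ) ^ (2 * n) * (p : ℂ) ^ (-s)) ^ (n - d) * ((p : ℂ) ^ (-s)) ^ (2 * n))‖
      = (p : ℝ) ^ (d * (n - d) + 2 * n * (n - d)) * q ^ (n - d + 2 * n) := by
        simp only [norm_mul, norm_pow, Complex.norm_natCast, ← hq]
        ring
    _ ≤ (p : ℝ) ^ ((2 * n - 1) * (n - d + 2 * n)) * q ^ (n - d + 2 * n) :=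
        mul_le_mul_of_nonneg_right (pow_le_pow_right₀ hp1.le hexp) (pow_nonneg hq0 _)
    _ = ((p : ℝ) ^ (2 * n - 1) * q) ^ (n - d + 2 * n) := by rw [mul_pow, ← pow_mul]
    _ < 1 := pow_lt_one₀ (by positivity) hq1 (by omega)

theorem numericalDatum_eq {n d : ℕ} (hd : d ≤ n) (s : ℂ) :
    numericalDatum p n s d = (p : ℂ) ^ (d * (n - d)) *
      (((p : ℂ) ^ (2 * n) * (p : ℂ) ^ (-s)) ^ (n - d) * ((p : ℂ) ^ (-s)) ^ (2 * n)) := by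
  have hp0 : (p : ℂ) ≠ 0 := Nat.cast_ne_zero.2 hp.out.ne_zero
  obtain ⟨t, rfl⟩ := Nat.exists_eq_add_of_le hd
  rw [Nat.add_sub_cancel_left, mul_pow, ← pow_mul, mul_assoc, ← pow_add, ← mul_assoc, ← pow_add,
    ← Complex.cpow_nat_mul, ← Complex.cpow_natCast, ← Complex.cpow_add _ _ hp0, numericalDatum]
  congr 1
  push_cast
  ring

end ZetaFunction

/-! ### The zeta function of ℤ_p^r -/

section FreeAbelian

variable {p : ℕ} [hp : Fact p.Prime]

/-- The open normal subgroups of `ℤ_p ^ r` are the `p`-lattices. -/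
noncomputable def openNormalEquivPLattice (r : ℕ) :
    OpenNormal (Multiplicative (Fin r → ℤ_[p])) ≃ PLattice p (Fin r → ℤ_[p]) where
  toFun N := ⟨Subgroup.toAddSubgroup' N.1,
    (isOpen_iff_isPLattice (isPFreeOfRank_fun_padicInt r)
      (fun _ => eq_zero_of_forall_mem_multiples_pow) _).1 N.2.2⟩
  invFun L := ⟨AddSubgroup.toSubgroup L.1, inferInstance,
    (isOpen_iff_isPLattice (isPFreeOfRank_fun_padicInt r)
      (fun _ => eq_zero_of_forall_mem_multiples_pow) _).2 L.2⟩
  left_inv _ := rfl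
  right_inv _ := rfl

theorem index_openNormalEquivPLattice {r : ℕ}
    (N : OpenNormal (Multiplicative (Fin r → ℤ_[p]))) :
    N.1.index = (openNormalEquivPLattice r N).1.index :=
  AddSubgroup.index_toSubgroup (openNormalEquivPLattice r N).1

theorem index_openNormal_ne_zero {r : ℕ} (N : OpenNormal (Multiplicative (Fin r → ℤ_[p]))) :
    N.1.index ≠ 0 := by
  rw [index_openNormalEquivPLattice]
  exact (isPFreeOfRank_fun_padicInt r).index_ne_zero (openNormalEquivPLattice r N).2

theorem cpow_index_openNormal {r : ℕ} (N : OpenNormal (Multiplicative (Fin r → ℤ_[p]))) (s : ℂ) :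
    (N.1.index : ℂ) ^ (-s) =
      ((p : ℂ) ^ (-s)) ^ padicValNat p (openNormalEquivPLattice r N).1.index *
        1 ^ (openNormalEquivPLattice r N).1.depth p := by
  obtain ⟨e, he⟩ := (isPFreeOfRank_fun_padicInt r).exists_index_eq_pow
    (openNormalEquivPLattice r N).2
  rw [one_pow, mul_one, index_openNormalEquivPLattice, natCast_cpow_neg_eq he]

theorem summable_openNormal_freeAbelian {r : ℕ} {s : ℂ} (hs : (r : ℝ) - 1 < s.re) :
    Summable fun N : OpenNormal (Multiplicative (Fin r → ℤ_[p])) => ‖(N.1.index : ℂ) ^ (-s)‖ := by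
  simp only [cpow_index_openNormal]
  exact (openNormalEquivPLattice r).summable_iff.2
    (summable_norm_lattice (isPFreeOfRank_fun_padicInt r) fun d hd => norm_padic_term_lt_one hs hd)

/-- By `tsum_lattice` with v = 1 both sums have the same closed form in p, r and s, so no
isomorphism between the two groups is needed. -/
theorem tsum_openNormal_freeAbelian {r : ℕ} {s : ℂ} (hr : 0 < r) (hs : (r : ℝ) - 1 < s.re)
    {V : Type*} [AddCommGroup V] (hV : IsPFreeOfRank p r V) :
    ∑' N : OpenNormal (Multiplicative (Fin r → ℤ_[p])), (N.1.index : ℂ) ^ (-s) =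
      ∑' L : PLattice p V, ((p : ℂ) ^ (-s)) ^ padicValNat p L.1.index * 1 ^ L.1.depth p := by
  have h : ∀ d < r, ‖(p : ℂ) ^ (d * (r - d)) * (((p : ℂ) ^ (-s)) ^ (r - d) * 1)‖ < 1 :=
    fun d hd => norm_padic_term_lt_one hs hd
  rw [tsum_lattice hV hr h, ← tsum_lattice (isPFreeOfRank_fun_padicInt r) hr h,
    ← (openNormalEquivPLattice r).tsum_eq]
  exact tsum_congr fun N => cpow_index_openNormal N s

end FreeAbelian

/-! ### Factorization of the zeta function of H(R) -/

section HeisenbergZeta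

open AddSubgroup

variable {p : ℕ} [hp : Fact p.Prime] {R : Type*} [CommRing R] [IsDomain R]
  [IsDiscreteValuationRing R]

/-- Pairs of a lattice in `R` and a lattice in `R × R`, together with a gluing homomorphism on the
scaled second lattice. -/
abbrev HeisDatum {n : ℕ} (hV : IsPFreeOfRank p n (R × R)) : Type _ :=
  Σ q : PLattice p R × PLattice p (R × R),
    ((scaledLatticeEquiv hV (q.1.1.depth p) q.2).1.1 →+ R ⧸ q.1.1)

/-- The parametrization of normal subgroups with lattice parts by pairs of arbitrary lattices and
gluing homomorphisms. -/
noncomputable def heisDatumEquiv {n : ℕ} (hV : IsPFreeOfRank p n (R × R))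
    (hirr : Irreducible (p : R)) :
    HeisDatum hV ≃ {N : Subgroup (heisenbergGroup R) // IsHeisLattice p N} :=
  (Equiv.sigmaAssocProd (γ := fun (L : PLattice p R) (M : PLattice p (R × R)) =>
      ((scaledLatticeEquiv hV (L.1.depth p) M).1.1 →+ R ⧸ L.1))).trans
    ((Equiv.sigmaCongrRight fun L : PLattice p R =>
      Equiv.sigmaCongrLeft (β := fun M : {M : PLattice p (R × R) // HeisCompat L.1 M.1} =>
        (M.1.1 →+ R ⧸ L.1)) ((scaledLatticeEquiv hV (L.1.depth p)).trans
        (Equiv.subtypeEquivRight fun M => (heisCompat_iff hirr L.2 M.1).symm))).trans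
    (heisLatticeEquiv p))

omit hp in
theorem centerPart_heisDatumEquiv {n : ℕ} (hV : IsPFreeOfRank p n (R × R))
    (hirr : Irreducible (p : R)) (x : HeisDatum hV) :
    centerPart (heisDatumEquiv hV hirr x).1 = x.1.1.1 :=
  centerPart_heisSub (L := x.1.1.1)
    ((heisCompat_iff hirr x.1.1.2 _).2 (scaledLatticeEquiv hV (x.1.1.1.depth p) x.1.2).2) x.2

omit hp in
theorem basePart_heisDatumEquiv {n : ℕ} (hV : IsPFreeOfRank p n (R × R))
    (hirr : Irreducible (p : R)) (x : HeisDatum hV) :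
    basePart (heisDatumEquiv hV hirr x).1 =
      (scaledLatticeEquiv hV (x.1.1.1.depth p) x.1.2).1.1 :=
  basePart_heisSub (L := x.1.1.1)
    ((heisCompat_iff hirr x.1.1.2 _).2 (scaledLatticeEquiv hV (x.1.1.1.depth p) x.1.2).2) x.2

variable {n : ℕ} (hR : IsPFreeOfRank p n R) (hV : IsPFreeOfRank p (2 * n) (R × R))
  (hirr : Irreducible (p : R))

include hR in
theorem cpow_index_heisDatumEquiv (x : HeisDatum hV) (s : ℂ) :
    ((heisDatumEquiv hV hirr x).1.index : ℂ) ^ (-s) =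
      ((p : ℂ) ^ (-s)) ^ padicValNat p x.1.1.1.index *
        (((p : ℂ) ^ (-s)) ^ (2 * n)) ^ x.1.1.1.depth p *
        (((p : ℂ) ^ (-s)) ^ padicValNat p x.1.2.1.index * 1 ^ x.1.2.1.depth p) := by
  obtain ⟨e, he⟩ := hR.exists_index_eq_pow x.1.1.2
  obtain ⟨e', he'⟩ := hV.exists_index_eq_pow x.1.2.2
  have := (heisDatumEquiv hV hirr x).2.1
  have hidx : (heisDatumEquiv hV hirr x).1.index = p ^ (e' + 2 * n * x.1.1.1.depth p + e) := by
    rw [index_eq_basePart_mul_centerPart, centerPart_heisDatumEquiv, basePart_heisDatumEquiv,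
      index_scaledLatticeEquiv, he, he', pow_add, pow_add]
  rw [natCast_cpow_neg_eq hidx, hidx, he, he', padicValNat.prime_pow, padicValNat.prime_pow,
    padicValNat.prime_pow]
  ring

variable [Algebra ℤ_[p] R] [Module.Finite ℤ_[p] R] [Module.Free ℤ_[p] R]

-- The scaled lattice is free of rank 2n over ℤ_p, so each basis vector may be sent anywhere in R/L.
omit [IsDomain R] [IsDiscreteValuationRing R] in
theorem card_gluing (hrank : Module.finrank ℤ_[p] (R × R) = 2 * n)
    (q : PLattice p R × PLattice p (R × R)) :
    Nat.card ((scaledLatticeEquiv hV (q.1.1.depth p) q.2).1.1 →+ R ⧸ q.1.1) =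
      q.1.1.index ^ (2 * n) := by
  rw [card_addMonoidHom_isPLattice (scaledLatticeEquiv hV (q.1.1.depth p) q.2).1.2
    (q.1.1.depth p) (pow_nsmul_quotient_eq_zero (pow_depth_nsmul_mem q.1.2)), hrank]
  rfl

omit [IsDomain R] [IsDiscreteValuationRing R] in
include hR in
theorem finite_gluing (hrank : Module.finrank ℤ_[p] (R × R) = 2 * n)
    (q : PLattice p R × PLattice p (R × R)) :
    Finite ((scaledLatticeEquiv hV (q.1.1.depth p) q.2).1.1 →+ R ⧸ q.1.1) := by
  refine Nat.finite_of_card_ne_zero ?_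
  rw [card_gluing hV hrank]
  exact pow_ne_zero _ (hR.index_ne_zero q.1.2)

-- Summing over the |R:L|^(2n) gluings replaces p^(-s) by p^(2n) p^(-s) in the index weight of L.
-- The terms then become products of a term in L and a term in M, and absolute convergence splits
-- the double sum.
include hR in
theorem summable_and_tsum_heisDatum (hrank : Module.finrank ℤ_[p] (R × R) = 2 * n) {s : ℂ}
    (hs : 2 * (n : ℝ) - 1 < s.re) :
    (Summable fun x : HeisDatum hV => ‖((heisDatumEquiv hV hirr x).1.index : ℂ) ^ (-s)‖) ∧
      ∑' x : HeisDatum hV, ((heisDatumEquiv hV hirr x).1.index : ℂ) ^ (-s) =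
        (∑' L : PLattice p R, ((p : ℂ) ^ (2 * n) * (p : ℂ) ^ (-s)) ^ padicValNat p L.1.index *
          (((p : ℂ) ^ (-s)) ^ (2 * n)) ^ L.1.depth p) *
        ∑' M : PLattice p (R × R),
          ((p : ℂ) ^ (-s)) ^ padicValNat p M.1.index * 1 ^ M.1.depth p := by
  have := finite_gluing hR hV hrank
  simp only [cpow_index_heisDatumEquiv hR hV hirr]
  have hL := summable_norm_lattice hR fun d hd => norm_heis_term_lt_one hs hd
  have hM := summable_norm_lattice (u := (p : ℂ) ^ (-s)) (v := 1) hV fun d hd =>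
    norm_padic_term_lt_one (s := s) (by push_cast; exact hs) hd
  have hterm (q : PLattice p R × PLattice p (R × R)) :
      (Nat.card ((scaledLatticeEquiv hV (q.1.1.depth p) q.2).1.1 →+ R ⧸ q.1.1) : ℂ) *
        (((p : ℂ) ^ (-s)) ^ padicValNat p q.1.1.index *
          (((p : ℂ) ^ (-s)) ^ (2 * n)) ^ q.1.1.depth p *
          (((p : ℂ) ^ (-s)) ^ padicValNat p q.2.1.index * 1 ^ q.2.1.depth p)) =
      (((p : ℂ) ^ (2 * n) * (p : ℂ) ^ (-s)) ^ padicValNat p q.1.1.index *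
          (((p : ℂ) ^ (-s)) ^ (2 * n)) ^ q.1.1.depth p) *
        (((p : ℂ) ^ (-s)) ^ padicValNat p q.2.1.index * 1 ^ q.2.1.depth p) := by
    obtain ⟨e, he⟩ := hR.exists_index_eq_pow q.1.2
    rw [card_gluing hV hrank, he, padicValNat.prime_pow]
    push_cast
    ring
  have hsum := (hL.mul_norm hM).congr fun q => congrArg norm (hterm q).symm
  obtain ⟨h1, h2⟩ := summable_sigma_const hsum
  refine ⟨h1, h2.trans ?_⟩
  rw [tsum_mul_tsum_of_summable_norm hL hM]
  exact tsum_congr hterm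

end HeisenbergZeta

/-! ### The unramified ring and the main theorem -/

section Unramified

/-- A nonzero z ∈ ℤ_p is a unit times p^k, and p ≠ 0 in R, so ℤ_p embeds in the domain R. Thus R is
torsion-free and finite over a principal ideal domain. -/
theorem free_of_maximalIdeal_eq_span (p : ℕ) [hp : Fact p.Prime] (R : Type*) [CommRing R]
    [IsDomain R] [IsDiscreteValuationRing R] [Algebra ℤ_[p] R] [Module.Finite ℤ_[p] R]
    (hirr : Irreducible (p : R)) : Module.Free ℤ_[p] R := by
  have hinj : Function.Injective (algebraMap ℤ_[p] R) := by
    rw [injective_iff_map_eq_zero]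
    intro z hz
    by_contra hne
    rw [PadicInt.unitCoeff_spec hne, map_mul, map_pow, map_natCast] at hz
    exact mul_ne_zero ((PadicInt.unitCoeff hne).isUnit.map (algebraMap ℤ_[p] R)).ne_zero
      (pow_ne_zero _ hirr.ne_zero) hz
  have : FaithfulSMul ℤ_[p] R := (faithfulSMul_iff_algebraMap_injective _ _).2 hinj
  infer_instance

end Unramified

theorem mainTheorem5 (p : ℕ) [Fact p.Prime] (R : Type*) [CommRing R] [IsDomain R]
    [IsDiscreteValuationRing R] [TopologicalSpace R] [IsTopologicalRing R] [CompactSpace R]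
    [T2Space R] [Algebra ℤ_[p] R] [Module.Finite ℤ_[p] R]
    (hunram : IsLocalRing.maximalIdeal R = Ideal.span {(p : R)})
    (n : ℕ) (hn : n = Module.finrank ℤ_[p] R) :
    (∀ m : ℕ, m ≠ 0 →
      (normalSubgroupsOfIndex (heisenbergGroup R) m).Finite ∧
      (normalSubgroupsOfIndex (Multiplicative (Fin (2 * n) → ℤ_[p])) m).Finite) ∧
    ∀ s : ℂ, 2 * (n : ℝ) - 1 < s.re →
      LSeriesSummable (normalSubgroupCount (heisenbergGroup R)) s ∧
      LSeriesSummable (normalSubgroupCount (Multiplicative (Fin (2 * n) → ℤ_[p]))) s ∧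
      normalZeta (heisenbergGroup R) s =
        normalZeta (Multiplicative (Fin (2 * n) → ℤ_[p])) s *
          (1 / (1 - numericalDatum p n s 0)) *
          ∑ I ∈ (Finset.Icc 1 (n - 1)).powerset,
            gaussMultinomial ((p : ℂ)⁻¹) n I *
              ∏ i ∈ I, numericalDatum p n s i / (1 - numericalDatum p n s i) := by
  have hirr : Irreducible (p : R) :=
    (IsDiscreteValuationRing.irreducible_iff_uniformizer _).2 hunram
  have := free_of_maximalIdeal_eq_span p R hirr
  have hn0 : 0 < n := hn ▸ Module.finrank_pos
  have hR : IsPFreeOfRank p n R := hn ▸ isPFreeOfRank_finrank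
  have hrank : Module.finrank ℤ_[p] (R × R) = 2 * n := by
    rw [Module.finrank_prod, ← hn, two_mul]
  have hV : IsPFreeOfRank p (2 * n) (R × R) := hrank ▸ isPFreeOfRank_finrank
  have hopen (N : Subgroup (heisenbergGroup R)) :=
    heisNormal_isOpen_iff hR (fun _ => eq_zero_of_forall_mem_multiples_pow) (N := N)
  let E : HeisDatum hV ≃ OpenNormal (heisenbergGroup R) :=
    (heisDatumEquiv hV hirr).trans (Equiv.subtypeEquivRight fun N => (hopen N).symm)
  have hsummable (s : ℂ) (hs : 2 * (n : ℝ) - 1 < s.re) :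
      Summable fun N : OpenNormal (heisenbergGroup R) => ‖(N.1.index : ℂ) ^ (-s)‖ :=
    E.summable_iff.1 (summable_and_tsum_heisDatum hR hV hirr hrank hs).1
  have hsummable' (s : ℂ) (hs : 2 * (n : ℝ) - 1 < s.re) :
      Summable fun N : OpenNormal (Multiplicative (Fin (2 * n) → ℤ_[p])) =>
        ‖(N.1.index : ℂ) ^ (-s)‖ :=
    summable_openNormal_freeAbelian (by push_cast; exact hs)
  have hindex (N : OpenNormal (heisenbergGroup R)) : N.1.index ≠ 0 := by
    have hN := (hopen N.1).1 N.2
    have := hN.1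
    rw [index_eq_basePart_mul_centerPart]
    exact mul_ne_zero (hV.index_ne_zero hN.2.2) (hR.index_ne_zero hN.2.1)
  refine ⟨fun m hm => ?_, fun s hs => ?_⟩
  -- Finiteness follows from summability at a single point; s = 2n lies in the half-plane.
  · have hs : 2 * (n : ℝ) - 1 < ((2 * n : ℕ) : ℂ).re := by
      rw [Complex.natCast_re]
      push_cast
      linarith
    exact ⟨finite_normalSubgroupsOfIndex (hsummable _ hs) hm,
      finite_normalSubgroupsOfIndex (hsummable' _ hs) hm⟩
  · have h1 := hasSum_normalZeta hindex (hsummable s hs)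
    have h2 := hasSum_normalZeta index_openNormal_ne_zero (hsummable' s hs)
    refine ⟨h1.summable, h2.summable, ?_⟩
    have hz : normalZeta (heisenbergGroup R) s = _ := h1.tsum_eq
    have hz' : normalZeta (Multiplicative (Fin (2 * n) → ℤ_[p])) s = _ := h2.tsum_eq
    have hE : ∑' N : OpenNormal (heisenbergGroup R), (N.1.index : ℂ) ^ (-s) = _ :=
      (E.tsum_eq _).symm.trans (summable_and_tsum_heisDatum hR hV hirr hrank hs).2
    rw [hz, hz', hE, tsum_openNormal_freeAbelian (by omega) (by push_cast; exact hs) hV,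
      tsum_lattice hR hn0 fun d hd => norm_heis_term_lt_one hs hd, mul_comm, mul_assoc,
      numericalDatum_eq (Nat.zero_le n)]
    congr 2
    refine Finset.sum_congr rfl fun I hI => ?_
    congr 1
    refine Finset.prod_congr rfl fun i hi => ?_
    have := Finset.mem_Icc.1 (Finset.mem_powerset.1 hI hi)
    rw [numericalDatum_eq (by omega)]
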